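/- Setup. An asset has to be sold before a deadline that is $t\ge 0$ time units away. Offers $X_1,X_2,\dots$ are i.i.d. with law $\nu$ and distribution function $F$, they arrive at the points of a Poisson process of rate $\lambda>0$ (the inter-arrival durations $D_1,D_2,\dots$ are i.i.d. exponential with rate $\lambda$), and if no offer has been accepted by the deadline the asset is sold at a residual price $X_0$ with law $\nu_0$ and distribution function $F_0$; all of the $D_i$, $X_i$, $X_0$ are independent. The time that remains when offer $i$ arrives is $t_i=(t_{i-1}-D_i)_+$, $t_0=t$. When offer $i$ arrives (with $t_i>0$) the seller, who knows $D_1,X_1,\dots,D_i,X_i$, either accepts it, and the sale price is $X_i$, or rejects it for good. Assume $E[(X_1)_+]<\infty$, $E|X_0|<\infty$, and $0\le\mu_0<M$, where $\mu_0=E[X_0]$ and $M=\sup\{x: F(x)<1\}\in(-\infty,\infty]$. Let $\mu(t)$ be the maximal (supremal) expected sale price over all stopping rules when the time to the deadline is $t$ and no offer is at hand. The optimal policy accepts the first offer with $t_i>0$ and $X_i\ge\mu(t_i)$. Let $S_t$ be the sale price realized under this policy, and $G_t(x)=P(S_t\le x)$. Put $\phi(x)=\int_x^\infty[1-F(u)]\,du$,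 and let $\phi'(x)$ denote the right derivative of $\phi$ at $x$, which exists and equals $F(x)-1$ for every $x$ (it is the ordinary derivative wherever $F$ is continuous). Theorem (distribution of the sale price). For every $t\ge 0$ the function $\phi$ is positive on $(-\infty,\mu(t)]$, $\mu_0\le\mu(t)$, the integrals below are finite, and for every $x\in\mathbb R$ $$G_t(x)=\phi(\mu(t))\left[\frac{F_0(x)}{\phi(\mu_0)}+\int_{\mu_0}^{\mu(t)}\frac{[F(x)-F(w)]_+}{\phi(w)^2}\,dw\right]$$ $$=\phi(\mu(t))\frac{F_0(x)}{\phi(\mu_0)}+\phi(\mu(t))\cdot\begin{cases}0 & x<\mu_0,\\[2pt] \dfrac1{\phi(x)}-\dfrac1{\phi(\mu_0)}+\phi'(x)\displaystyle\int_{\mu_0}^{x}\frac{dw}{\phi(w)^2} & \mu_0\le x<\mu(t),\\[2pt] \dfrac1{\phi(\mu(t))}-\dfrac1{\phi(\mu_0)}+\phi'(x)\displaystyle\int_{\mu_0}^{\mu(t)}\frac{dw}{\phi(w)^2} & x\ge\mu(t).\end{cases}$$ If moreover $F$ and $F_0$ are absolutely continuous with densities $f$ and $f_0$, then the law of $S_t$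 is absolutely continuous, with density $$g_t(x)=\phi(\mu(t))\frac{f_0(x)}{\phi(\mu_0)}+\phi(\mu(t))f(x)\cdot\begin{cases}0 & x<\mu_0,\\[2pt] \displaystyle\int_{\mu_0}^{x}\frac{dw}{\phi(w)^2} & \mu_0\le x<\mu(t),\\[2pt] \displaystyle\int_{\mu_0}^{\mu(t)}\frac{dw}{\phi(w)^2} & x\ge\mu(t).\end{cases}$$ -/

import Mathlib

open MeasureTheory ProbabilityTheory Set

noncomputable section

/-- The random inputs of the bidding process: independent inter-arrival durations `D n`,
exponential with parameter `rate`, independent offers `X n` with law `ν` (so that the CDF of the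
offers is `cdf ν`), and a residual price `X₀` with law `ν₀`; all of them are mutually
independent. Offers are numbered from `0`. -/
structure BiddingProcess {Ω : Type*} [MeasurableSpace Ω] (P : Measure Ω) (rate : ℝ)
    (ν ν₀ : Measure ℝ) where
  D : ℕ → Ω → ℝ
  X : ℕ → Ω → ℝ
  X₀ : Ω → ℝ
  measurable_D : ∀ n, Measurable (D n)
  measurable_X : ∀ n, Measurable (X n)
  measurable_X₀ : Measurable X₀
  map_D : ∀ n, P.map (D n) = expMeasure rate
  map_X : ∀ n, P.map (X n) = ν
  map_X₀ : P.map X₀ = ν₀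
  indep : iIndepFun (Sum.elim (Sum.elim D X) (fun _ : Unit => X₀)) P

namespace BiddingProcess

/-- The time to the deadline: `timeLeft t 0 = t`, and `timeLeft t (n + 1)` is the time that remains
when offer `n` arrives (`0` if the deadline has been reached by then). -/
def timeLeft {Ω : Type*} [MeasurableSpace Ω] {P : Measure Ω} {rate : ℝ} {ν ν₀ : Measure ℝ}
    (B : BiddingProcess P rate ν ν₀) (t : ℝ) : ℕ → Ω → ℝ
  | 0, _ => t
  | n + 1, ω => max (B.timeLeft t n ω - B.D n ω) 0

/-- The information of the seller: at stage `n`, the arrivals and the sizes of offers `0, …, n`. -/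
def history {Ω : Type*} [mΩ : MeasurableSpace Ω] {P : Measure Ω} {rate : ℝ} {ν ν₀ : Measure ℝ}
    (B : BiddingProcess P rate ν ν₀) : Filtration ℕ mΩ :=
  Filtration.natural (fun n ω => (B.D n ω, B.X n ω))
    (fun n => ((B.measurable_D n).prodMk (B.measurable_X n)).stronglyMeasurable)

/-- The payoff, with initial time to deadline `t`, of the rule that accepts offer number `τ`:
that offer if it arrives before the deadline, and otherwise (in particular if `τ = ⊤`, where no
offer is ever accepted) the residual price. -/
def payoff {Ω : Type*} [MeasurableSpace Ω] {P : Measure Ω} {rate : ℝ} {ν ν₀ : Measure ℝ}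
    (B : BiddingProcess P rate ν ν₀) (t : ℝ) (τ : Ω → WithTop ℕ) (ω : Ω) : ℝ :=
  open Classical in
  if τ ω ≠ ⊤ ∧ 0 < B.timeLeft t ((τ ω).untopD 0 + 1) ω then B.X ((τ ω).untopD 0) ω else B.X₀ ω

/-- The optimal policy function: the maximal expected payoff over all stopping rules when the
time to the deadline is `t` and no offer is at hand, that is, the value of rejecting an offer at
that time. (When offers and residual price have integrable positive parts, a rule whose payoff is
not integrable has expected payoff `-∞`, so that leaving it out does not change the supremum.) -/
def policy {Ω : Type*} [MeasurableSpace Ω] {P : Measure Ω} {rate : ℝ} {ν ν₀ : Measure ℝ}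
    (B : BiddingProcess P rate ν ν₀) (t : ℝ) : ℝ :=
  sSup {v : ℝ | ∃ τ : Ω → WithTop ℕ, IsStoppingTime B.history τ ∧
    Integrable (B.payoff t τ) P ∧ v = ∫ ω, B.payoff t τ ω ∂P}

/-- The number of the first offer that arrives before the deadline and is at least the value of
the optimal policy function at its time of arrival (`⊤` if there is none). -/
def optimalRule {Ω : Type*} [MeasurableSpace Ω] {P : Measure Ω} {rate : ℝ} {ν ν₀ : Measure ℝ}
    (B : BiddingProcess P rate ν ν₀) (t : ℝ) (ω : Ω) : WithTop ℕ :=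
  open Classical in
  if h : ∃ n : ℕ, 0 < B.timeLeft t (n + 1) ω ∧ B.policy (B.timeLeft t (n + 1) ω) ≤ B.X n ω
  then ((Nat.find h : ℕ) : WithTop ℕ) else ⊤

/-- The realized sale price `S_t` under the optimal policy. -/
def salePrice {Ω : Type*} [MeasurableSpace Ω] {P : Measure Ω} {rate : ℝ} {ν ν₀ : Measure ℝ}
    (B : BiddingProcess P rate ν ν₀) (t : ℝ) (ω : Ω) : ℝ :=
  B.payoff t (B.optimalRule t) ω

/-- The cumulative distribution function `G_t` of the realized sale price. -/
def salePriceCDF {Ω : Type*} [MeasurableSpace Ω] {P : Measure Ω} {rate : ℝ} {ν ν₀ : Measure ℝ}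
    (B : BiddingProcess P rate ν ν₀) (t x : ℝ) : ℝ :=
  P.real {ω | B.salePrice t ω ≤ x}

end BiddingProcess

/-- The maximum `M` of the support of the offer distribution, `⊤` if it is unbounded above. -/
def supportSup (ν : Measure ℝ) : EReal :=
  sSup ((fun x : ℝ => (x : EReal)) '' {x : ℝ | cdf ν x < 1})

/-- `φ(x) = ∫_x^∞ (1 - F(u)) du`, where `F` is the CDF of `ν`. -/
def phi (ν : Measure ℝ) (x : ℝ) : ℝ := ∫ u in Ioi x, (1 - cdf ν u)

/-- The right derivative of `φ`. -/
def phiDeriv (ν : Measure ℝ) (x : ℝ) : ℝ := derivWithin (phi ν) (Ici x) x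

end

/-!
The value `μ(t)` of having time `t` left should satisfy `μ' = rate * φ(μ)`, `μ(0) = μ₀`: in a short
time an offer `X` arrives with probability `rate * dt`, and taking the better of `X` and `μ` gains
`E (X - μ)₊ = φ(μ)` (`integral_max_eq_add_phi`). As `φ` is Lipschitz, nonnegative and nonincreasing,
this equation has a solution `m` on `[0, ∞)` (`exists_isValueFunction`), which stays below the top
of the support of the offers, so that `φ(m) > 0` (`IsValueFunction.phi_pos`).

Differential equations of the form `H' = rate * (k - H)` are turned into renewal equations:
`H s` is the mean of `k` at the time left after an exponential duration, with `H 0` in place of `k`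
if the deadline comes first (`integral_expMeasure_eq_of_rightDeriv`). Only right derivatives are
needed, and `k` matters up to null sets; this deals with the atoms of the offer distribution, as
the strictly increasing `m` meets its countably many atoms at countably many times.

The renewal equation says that `H` of the time left, stopped at the time of sale, is a martingale
for the threshold rule that accepts an offer if it is at least `m` of the time left. For other
rules, and with `H = m`, it is a supermartingale, since accepting or rejecting gives at most
`max X m`. The deadline is reached after finitely many offers, so that the expectation of the final
reward is (at most) `H t` (`integral_le_of_supersolution`); the residual price is
independent of the decisions and may be replaced by its mean (`integrable_reward_and_integral_eq`).
With the sale price itself as the reward this identifies the policy function with `m` and the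
optimal rule with the threshold rule of `m` (`policy_eq`).

With the indicator of `{price ≤ x}` as the reward, the mean is `G_t(x)`. The right-hand side of the
formula, `K(y) = φ(y) (F₀(x) / φ(μ₀) + ∫_{μ₀}^y (F(x) - F(w))₊ / φ(w)² dw)` at `y = m(t)`, has
right derivative `φ(y) K'(y) = (F(y) - 1) K(y) + (F(x) - F(y))₊`, so that `H = K ∘ m` satisfies
`H' = rate * (F(m) H + (F(x) - F(m))₊ - H)`, which is the renewal equation of the threshold rule:
an offer below `m` leaves `H`, and one in `[m, x]` counts as `1` (`renewal_priceCDF`). The piecewise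
form follows from `(1 / φ)' = (1 - F) / φ²`, and the density from Tonelli's theorem.
-/

/-! ### The expected excess of an offer over a level -/

lemma one_sub_cdf_eq_measureReal_Ioi (ν : Measure ℝ) [IsProbabilityMeasure ν] (u : ℝ) :
    1 - cdf ν u = ν.real (Ioi u) := by
  rw [cdf_eq_real, ← compl_Iic, measureReal_compl measurableSet_Iic]
  simp

lemma measurable_cdf (ν : Measure ℝ) : Measurable (cdf ν) := (monotone_cdf ν).measurable

lemma intervalIntegrable_one_sub_cdf (ν : Measure ℝ) (a b : ℝ) :
    IntervalIntegrable (fun u => 1 - cdf ν u) volume a b :=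
  AntitoneOn.intervalIntegrable fun _ _ _ _ h => sub_le_sub_left (monotone_cdf ν h) 1

lemma phi_nonneg (ν : Measure ℝ) (x : ℝ) : 0 ≤ phi ν x :=
  setIntegral_nonneg measurableSet_Ioi fun u _ => sub_nonneg.2 (cdf_le_one ν u)

section Phi

variable {ν : Measure ℝ} [IsProbabilityMeasure ν]

lemma integrable_max_sub_zero (hν : Integrable (fun x : ℝ => max x 0) ν) (x : ℝ) :
    Integrable (fun y : ℝ => max (y - x) 0) ν := by
  refine (hν.add (integrable_const |x|)).mono' (by fun_prop) (ae_of_all _ fun y => ?_)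
  rw [Real.norm_eq_abs, abs_of_nonneg (le_max_right _ _)]
  have := neg_abs_le x
  have := le_max_left y 0
  have := le_max_right y 0
  have := abs_nonneg x
  exact max_le (by simp only [Pi.add_apply]; linarith) (by simp only [Pi.add_apply]; linarith)

lemma integrableOn_one_sub_cdf (hν : Integrable (fun x : ℝ => max x 0) ν) (x : ℝ) :
    IntegrableOn (fun u => 1 - cdf ν u) (Ioi x) := by
  have h0 : IntegrableOn (fun u => 1 - cdf ν u) (Ioi 0) := by
    have key := lintegral_eq_lintegral_meas_lt ν (ae_of_all _ fun y : ℝ => le_max_right y 0)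
      hν.aemeasurable
    have hfin := hν.lintegral_lt_top
    refine ⟨((measurable_const.sub (measurable_cdf ν))).aestronglyMeasurable, ?_⟩
    rw [HasFiniteIntegral]
    rw [key] at hfin
    refine lt_of_le_of_lt (le_of_eq ?_) hfin
    refine setLIntegral_congr_fun measurableSet_Ioi fun u (hu : 0 < u) => ?_
    have : {a : ℝ | u < max a 0} = Ioi u := by
      ext a; simp [not_lt.2 hu.le]
    simp only [this, one_sub_cdf_eq_measureReal_Ioi]
    rw [Real.enorm_eq_ofReal measureReal_nonneg, ofReal_measureReal]
  rcases le_total 0 x with h | h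
  · exact h0.mono_set (Ioi_subset_Ioi h)
  · rw [← Ioc_union_Ioi_eq_Ioi h]
    exact ((intervalIntegrable_iff_integrableOn_Ioc_of_le h).1
      (intervalIntegrable_one_sub_cdf ν x 0)).union h0

lemma phi_eq_integral_max (hν : Integrable (fun x : ℝ => max x 0) ν) (x : ℝ) :
    phi ν x = ∫ y, max (y - x) 0 ∂ν := by
  rw [(integrable_max_sub_zero hν x).integral_eq_integral_meas_lt
    (ae_of_all _ fun y => le_max_right _ _), phi]
  have hs : (fun u : ℝ => u + x) ⁻¹' Ioi x = Ioi 0 := by ext u; simp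
  rw [← (measurePreserving_add_right volume x).setIntegral_preimage_emb
    (measurableEmbedding_addRight x), hs]
  refine setIntegral_congr_fun measurableSet_Ioi fun u (hu : 0 < u) => ?_
  have : {a : ℝ | u < max (a - x) 0} = Ioi (u + x) := by
    ext a; simp [not_lt.2 hu.le, lt_sub_iff_add_lt]
  simp only [this, one_sub_cdf_eq_measureReal_Ioi]

lemma phi_sub_phi (hν : Integrable (fun x : ℝ => max x 0) ν) (x y : ℝ) :
    phi ν x - phi ν y = ∫ u in x..y, (1 - cdf ν u) :=
  intervalIntegral.integral_Ioi_sub_Ioi' (integrableOn_one_sub_cdf hν x)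
    (integrableOn_one_sub_cdf hν y)

lemma antitone_phi (hν : Integrable (fun x : ℝ => max x 0) ν) : Antitone (phi ν) := by
  intro x y h
  rw [← sub_nonneg, phi_sub_phi hν]
  exact intervalIntegral.integral_nonneg h fun u _ => sub_nonneg.2 (cdf_le_one ν u)

lemma phi_sub_phi_le (hν : Integrable (fun x : ℝ => max x 0) ν) {x y : ℝ} (h : x ≤ y) :
    phi ν x - phi ν y ≤ y - x := by
  rw [phi_sub_phi hν]
  calc _ ≤ ∫ u in x..y, (1 : ℝ) := intervalIntegral.integral_mono_on h
          (intervalIntegrable_one_sub_cdf ν x y) (by simp)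
          fun u _ => sub_le_self _ (cdf_nonneg ν u)
    _ = y - x := by simp

lemma lipschitzWith_phi (hν : Integrable (fun x : ℝ => max x 0) ν) : LipschitzWith 1 (phi ν) := by
  refine LipschitzWith.of_dist_le_mul fun x y => ?_
  rw [Real.dist_eq, Real.dist_eq, NNReal.coe_one, one_mul]
  wlog h : x ≤ y generalizing x y
  · rw [abs_sub_comm, abs_sub_comm x]; exact this y x (le_of_not_ge h)
  rw [abs_of_nonneg (sub_nonneg.2 (antitone_phi hν h)), abs_sub_comm,
    abs_of_nonneg (sub_nonneg.2 h)]
  exact phi_sub_phi_le hν h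

lemma hasDerivWithinAt_phi (hν : Integrable (fun x : ℝ => max x 0) ν) (x : ℝ) :
    HasDerivWithinAt (phi ν) (cdf ν x - 1) (Ici x) x := by
  have h : HasDerivWithinAt (fun u => ∫ w in x..u, (1 - cdf ν w)) (1 - cdf ν x) (Ici x) x :=
    intervalIntegral.integral_hasDerivWithinAt_right (by simp)
      ((measurable_const.sub (measurable_cdf ν)).stronglyMeasurable.stronglyMeasurableAtFilter)
      ((continuousWithinAt_const.sub ((cdf ν).right_continuous x)).mono Ioi_subset_Ici_self)
  have h2 := h.const_sub (phi ν x)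
  rw [neg_sub] at h2
  exact h2.congr (fun u _ => by rw [← phi_sub_phi hν]; ring) (by simp)

lemma phiDeriv_eq (hν : Integrable (fun x : ℝ => max x 0) ν) (x : ℝ) :
    phiDeriv ν x = cdf ν x - 1 :=
  (hasDerivWithinAt_phi hν x).derivWithin (uniqueDiffWithinAt_Ici x)

lemma phi_pos_of_lt_supportSup (hν : Integrable (fun x : ℝ => max x 0) ν) {x : ℝ}
    (hx : (x : EReal) < supportSup ν) : 0 < phi ν x := by
  obtain ⟨_, ⟨y, hy, rfl⟩, hxy⟩ := lt_sSup_iff.1 hx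
  have hxy : x < y := EReal.coe_lt_coe_iff.1 hxy
  have hy : cdf ν y < 1 := hy
  have h1 : (y - x) * (1 - cdf ν y) ≤ phi ν x - phi ν y := by
    rw [phi_sub_phi hν]
    calc (y - x) * (1 - cdf ν y) = ∫ u in x..y, (1 - cdf ν y) := by
          rw [intervalIntegral.integral_const, smul_eq_mul]
      _ ≤ _ := intervalIntegral.integral_mono_on hxy.le (by simp)
          (intervalIntegrable_one_sub_cdf ν x y)
          fun u hu => sub_le_sub_left (monotone_cdf ν hu.2) 1
  have := phi_nonneg ν y
  have := mul_pos (sub_pos.2 hxy) (sub_pos.2 hy)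
  linarith

/-- The expected value of the better of an offer and a sure amount `x` exceeds `x` by `φ x`. -/
lemma integral_max_eq_add_phi (hν : Integrable (fun x : ℝ => max x 0) ν) (x : ℝ) :
    ∫ y, max y x ∂ν = x + phi ν x := by
  have h : (fun y : ℝ => max y x) = fun y => x + max (y - x) 0 := by
    ext y; rw [← max_add_add_left]; simp
  rw [h, integral_add (integrable_const _) (integrable_max_sub_zero hν x), phi_eq_integral_max hν]
  simp

end Phi

/-! ### The value function and the renewal form of its differential equation -/

lemma le_of_rightDeriv_nonneg {g g' : ℝ → ℝ} {a b : ℝ} (hab : a ≤ b) (hg : ContinuousOn g (Icc a b))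
    (hg' : ContinuousOn g' (Icc a b))
    (hd : ∀ s ∈ Icc a b, HasDerivWithinAt g (g' s) (Ici s) s) (h0 : ∀ s ∈ Icc a b, 0 ≤ g' s) :
    g a ≤ g b := by
  rw [← sub_nonneg, ← intervalIntegral.integral_eq_sub_of_hasDeriv_right_of_le hab hg
    (fun s hs => (hd s (Ioo_subset_Icc_self hs)).mono Ioi_subset_Ici_self)
    (hg'.intervalIntegrable_of_Icc hab)]
  exact intervalIntegral.integral_nonneg hab h0

/-- `m` solves `m' = rate * φ(m)`, `m(0) = μ₀` on `[0, ∞)`; it is extended to the left by the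
constant `μ₀`, so that it is continuous on the whole line. The derivative is a right derivative. -/
structure IsValueFunction (rate : ℝ) (ν : Measure ℝ) (μ₀ : ℝ) (m : ℝ → ℝ) : Prop where
  continuous : Continuous m
  eq_of_nonpos : ∀ s ≤ 0, m s = μ₀
  hasDerivWithinAt : ∀ s, 0 ≤ s → HasDerivWithinAt m (rate * phi ν (m s)) (Ici s) s

lemma exists_isValueFunction {rate : ℝ} (hrate : 0 < rate) {ν : Measure ℝ} [IsProbabilityMeasure ν]
    (hν : Integrable (fun x : ℝ => max x 0) ν) (μ₀ : ℝ) :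
    ∃ m, IsValueFunction rate ν μ₀ m := by
  -- Stopping the vector field at `μ₀` makes it bounded, so that it can be integrated for all times.
  set f : ℝ → ℝ := fun x => rate * phi ν (max x μ₀) with hf
  have hLip : LipschitzWith rate.toNNReal f := by
    have h1 : LipschitzWith 1 fun x => phi ν (max x μ₀) := by
      have h2 := (lipschitzWith_phi hν).comp (LipschitzWith.id.max_const μ₀)
      rwa [mul_one] at h2
    refine LipschitzWith.of_dist_le_mul fun x y => ?_
    have := h1.dist_le_mul x y
    rw [Real.dist_eq, Real.dist_eq] at *
    rw [← mul_sub, abs_mul, abs_of_pos hrate, Real.coe_toNNReal _ hrate.le]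
    exact mul_le_mul_of_nonneg_left (by simpa using this) hrate.le
  have hf0 : ∀ x, 0 ≤ f x := fun x => mul_nonneg hrate.le (phi_nonneg ν _)
  have hfb : ∀ x, f x ≤ f μ₀ := fun x => mul_le_mul_of_nonneg_left
    (antitone_phi hν (by simp)) hrate.le
  have hex : ∀ n : ℕ, ∃ α : ℝ → ℝ, α 0 = μ₀ ∧
      ∀ s ∈ Icc (0 : ℝ) n, HasDerivWithinAt α (f (α s)) (Icc (0 : ℝ) n) s := by
    intro n
    have hP : IsPicardLindelof (fun _ => f) (tmin := 0) (tmax := n)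
        (⟨0, left_mem_Icc.2 n.cast_nonneg⟩ : Icc (0 : ℝ) n) μ₀ ((f μ₀).toNNReal * n) 0
        (f μ₀).toNNReal rate.toNNReal :=
      { lipschitzOnWith := fun _ _ => hLip.lipschitzOnWith
        continuousOn := fun _ _ => continuousOn_const
        norm_le := fun _ _ x _ => by
          rw [Real.coe_toNNReal _ (hf0 _), Real.norm_eq_abs, abs_of_nonneg (hf0 x)]
          exact hfb x
        mul_max_le := by simp }
    exact hP.exists_eq_forall_mem_Icc_hasDerivWithinAt₀
  choose α hα0 hα using hex
  have hαc : ∀ n : ℕ, ContinuousOn (α n) (Icc 0 n) := fun n s hs => (hα n s hs).continuousWithinAt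
  have hαr : ∀ n : ℕ, ∀ s ∈ Ico (0 : ℝ) n, HasDerivWithinAt (α n) (f (α n s)) (Ici s) s :=
    fun n s hs => (hα n s (Ico_subset_Icc_self hs)).mono_of_mem_nhdsWithin
      (mem_nhdsWithin.2 ⟨Iio n, isOpen_Iio, hs.2, fun u hu => ⟨hs.1.trans hu.2, hu.1.le⟩⟩)
  -- By uniqueness the solutions on `[0, n]` agree, and they are glued to one on `[0, ∞)`.
  have hag : ∀ n k : ℕ, n ≤ k → EqOn (α n) (α k) (Icc 0 n) := by
    intro n k hnk
    have hnk' : (n : ℝ) ≤ k := by exact_mod_cast hnk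
    exact ODE_solution_unique (v := fun _ => f) (fun _ => hLip) (hαc n) (hαr n)
      ((hαc k).mono (Icc_subset_Icc_right hnk'))
      (fun s hs => hαr k s ⟨hs.1, hs.2.trans_le hnk'⟩) ((hα0 n).trans (hα0 k).symm)
  set m : ℝ → ℝ := fun s => α ⌈s⌉₊ (max s 0) with hm
  have hmα : ∀ n : ℕ, ∀ s ≤ (n : ℝ), m s = α n (max s 0) := fun n s hs =>
    hag _ _ (Nat.ceil_le.2 hs) ⟨le_max_right _ _, max_le (Nat.le_ceil s) (Nat.cast_nonneg _)⟩
  have hmc : Continuous m := by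
    rw [continuous_iff_continuousAt]
    intro s
    obtain ⟨n, hn⟩ := exists_nat_gt s
    have : ContinuousOn m (Iic n) := by
      refine ContinuousOn.congr (f := fun s => α n (max s 0)) ?_ (hmα n)
      exact (hαc n).comp (by fun_prop) fun u (hu : u ≤ n) =>
        ⟨le_max_right _ _, max_le hu n.cast_nonneg⟩
    exact this.continuousAt (Iic_mem_nhds hn)
  have hmd : ∀ s, 0 ≤ s → HasDerivWithinAt m (f (m s)) (Ici s) s := by
    intro s hs
    obtain ⟨n, hn⟩ := exists_nat_gt s
    have hms : m s = α n s := by rw [hmα n s hn.le, max_eq_left hs]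
    rw [hms]
    refine (hαr n s ⟨hs, hn⟩).congr_of_eventuallyEq ?_ hms
    filter_upwards [self_mem_nhdsWithin, mem_nhdsWithin_of_mem_nhds (Iio_mem_nhds hn)] with u hu hu'
    rw [hmα n u (le_of_lt hu'), max_eq_left (hs.trans hu)]
  have hm0 : ∀ s ≤ 0, m s = μ₀ := fun s hs => by
    rw [hmα 0 s (by simpa using hs), max_eq_right hs, hα0]
  have hge : ∀ s, μ₀ ≤ m s := by
    intro s
    rcases le_total s 0 with h | h
    · exact (hm0 s h).ge
    · rw [← hm0 0 le_rfl]
      exact le_of_rightDeriv_nonneg h hmc.continuousOn (hLip.continuous.comp hmc).continuousOn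
        (fun u hu => hmd u hu.1) fun u _ => hf0 _
  refine ⟨m, hmc, hm0, fun s hs => ?_⟩
  have hfs : f (m s) = rate * phi ν (m s) := by rw [hf]; simp only [max_eq_left (hge s)]
  exact hfs ▸ hmd s hs

namespace IsValueFunction

variable {rate : ℝ} {ν : Measure ℝ} {μ₀ : ℝ} {m : ℝ → ℝ}

lemma monotone [IsProbabilityMeasure ν] (h : IsValueFunction rate ν μ₀ m) (hrate : 0 < rate)
    (hν : Integrable (fun x : ℝ => max x 0) ν) : Monotone m := by
  have key : ∀ a b, 0 ≤ a → a ≤ b → m a ≤ m b := fun a b ha hab =>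
    le_of_rightDeriv_nonneg hab h.continuous.continuousOn
      (g' := fun s => rate * phi ν (m s))
      (((lipschitzWith_phi hν).continuous.comp h.continuous).const_smul rate).continuousOn
      (fun s hs => h.hasDerivWithinAt s (ha.trans hs.1))
      fun s _ => mul_nonneg hrate.le (phi_nonneg ν _)
  intro a b hab
  rcases le_total 0 a with ha | ha
  · exact key a b ha hab
  rw [h.eq_of_nonpos a ha]
  rcases le_total b 0 with hb | hb
  · exact (h.eq_of_nonpos b hb).ge
  · rw [← h.eq_of_nonpos 0 le_rfl]
    exact key 0 b le_rfl hb

lemma initial_le [IsProbabilityMeasure ν] (h : IsValueFunction rate ν μ₀ m) (hrate : 0 < rate)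
    (hν : Integrable (fun x : ℝ => max x 0) ν) (s : ℝ) : μ₀ ≤ m s := by
  rw [← h.eq_of_nonpos (min s 0) (min_le_right _ _)]
  exact h.monotone hrate hν (min_le_left _ _)

/-- The value function does not reach the top of the support of the offers in finite time: if
`φ (m s) = 0`, then `φ (m u) ≤ m s - m u` for `u ≤ s`, so that `exp (rate * u) * (m s - m u)` is
nondecreasing, from a positive value at `u = 0` to the value `0` at `u = s`. -/
lemma phi_pos [IsProbabilityMeasure ν] (h : IsValueFunction rate ν μ₀ m) (hrate : 0 < rate)
    (hν : Integrable (fun x : ℝ => max x 0) ν) (hφ : 0 < phi ν μ₀) (s : ℝ) :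
    0 < phi ν (m s) := by
  rcases le_total s 0 with hs | hs
  · rwa [h.eq_of_nonpos s hs]
  refine (phi_nonneg ν _).lt_of_ne fun h0 => ?_
  have hφc : Continuous (phi ν) := (lipschitzWith_phi hν).continuous
  have hmc := h.continuous
  have hd : ∀ u ∈ Icc 0 s, HasDerivWithinAt (fun u => Real.exp (rate * u) * (m s - m u))
      (Real.exp (rate * u) * rate * ((m s - m u) - phi ν (m u))) (Ici u) u := by
    intro u hu
    have h1 : HasDerivWithinAt (fun u => Real.exp (rate * u)) (Real.exp (rate * u) * rate)
        (Ici u) u := by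
      simpa using ((hasDerivAt_id u).const_mul rate).exp.hasDerivWithinAt
    have h2 := h1.mul ((h.hasDerivWithinAt u hu.1).const_sub (m s))
    convert! h2 using 1
    ring
  have := le_of_rightDeriv_nonneg hs (by fun_prop) (by fun_prop) hd fun u hu => by
    have := phi_sub_phi_le hν (h.monotone hrate hν hu.2)
    refine mul_nonneg (by positivity) (by linarith)
  rw [h.eq_of_nonpos 0 le_rfl, sub_self, mul_zero, mul_zero, Real.exp_zero, one_mul] at this
  have h3 : m s = μ₀ := le_antisymm (by linarith) (h.initial_le hrate hν s)
  rw [h3] at h0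
  exact hφ.ne h0

lemma strictMonoOn [IsProbabilityMeasure ν] (h : IsValueFunction rate ν μ₀ m) (hrate : 0 < rate)
    (hν : Integrable (fun x : ℝ => max x 0) ν) (hφ : 0 < phi ν μ₀) :
    StrictMonoOn m (Ici 0) := by
  intro a ha b _ hab
  have hφc : Continuous (phi ν) := (lipschitzWith_phi hν).continuous
  have hmc := h.continuous
  have hc : Continuous fun s => rate * phi ν (m s) := by fun_prop
  rw [← sub_pos, ← intervalIntegral.integral_eq_sub_of_hasDeriv_right_of_le hab.le hmc.continuousOn
    (fun s hs => (h.hasDerivWithinAt s (le_trans ha hs.1.le)).mono Ioi_subset_Ici_self)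
    (hc.intervalIntegrable _ _)]
  exact intervalIntegral.intervalIntegral_pos_of_pos (hc.intervalIntegrable _ _)
    (fun s => mul_pos hrate (h.phi_pos hrate hν hφ s)) hab

end IsValueFunction

lemma integral_expMeasure {rate : ℝ} (hrate : 0 < rate) (f : ℝ → ℝ) :
    ∫ d, f d ∂(expMeasure rate) = ∫ d in Ioi 0, rate * Real.exp (-(rate * d)) * f d := by
  have h : expMeasure rate = volume.withDensity (exponentialPDF rate) := rfl
  have hmeas : Measurable (exponentialPDF rate) :=
    (measurable_exponentialPDFReal rate).ennreal_ofReal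
  rw [h, integral_withDensity_eq_integral_toReal_smul hmeas (by simp [exponentialPDF]),
    ← integral_indicator measurableSet_Ioi]
  refine integral_congr_ae ?_
  filter_upwards [Measure.ae_ne volume (0 : ℝ)] with d hd
  rcases lt_or_gt_of_ne hd with h0 | h0
  · simp [exponentialPDF_of_neg h0, h0.le]
  · rw [exponentialPDF_of_nonneg h0.le, ENNReal.toReal_ofReal (by positivity),
      indicator_of_mem (mem_Ioi.2 h0), smul_eq_mul]

/-- The renewal form of a linear differential equation: if `H' = rate * (k - H)` and `H 0 = c`,
then `H s` is the mean of `k` at the time left after an exponential duration, with `c` in place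
of `k` if the duration is at least `s`. -/
lemma integral_expMeasure_eq_of_rightDeriv {rate T : ℝ} (hrate : 0 < rate) {H k k' : ℝ → ℝ}
    (hH : Continuous H) (hk : Measurable k) {C : ℝ} (hkC : ∀ s ∈ Icc 0 T, |k s| ≤ C)
    (hkk' : ∀ᵐ s ∂volume.restrict (Ioc 0 T), k' s = k s)
    (hd : ∀ s ∈ Ioo 0 T, HasDerivWithinAt H (rate * (k' s - H s)) (Ioi s) s)
    {s : ℝ} (hs : s ∈ Icc 0 T) :
    ∫ d, (if d < s then k (s - d) else H 0) ∂(expMeasure rate) = H s := by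
  have hIk : IntervalIntegrable (fun u => rate * Real.exp (rate * u) * k u) volume 0 s := by
    have : IntervalIntegrable k volume 0 s := by
      rw [intervalIntegrable_iff_integrableOn_Ioc_of_le hs.1]
      refine Measure.integrableOn_of_bounded (M := C) (by simp) hk.aestronglyMeasurable ?_
      filter_upwards [ae_restrict_mem measurableSet_Ioc] with u hu
      exact hkC u ⟨hu.1.le, hu.2.trans hs.2⟩
    exact this.continuousOn_mul (by fun_prop)
  have hkk : ∀ᵐ u ∂volume.restrict (Ioc 0 s), k' u = k u :=
    ae_restrict_of_ae_restrict_of_subset (Ioc_subset_Ioc_right hs.2) hkk'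
  have hcongr : (fun u => rate * Real.exp (rate * u) * k u)
      =ᵐ[volume.restrict (uIoc 0 s)] fun u => rate * Real.exp (rate * u) * k' u := by
    rw [uIoc_of_le hs.1]
    filter_upwards [hkk] with u hu
    rw [hu]
  -- The right derivative of `exp (rate * u) * H u` is `rate * exp (rate * u) * k' u`.
  have hFTC : ∫ u in 0..s, rate * Real.exp (rate * u) * k u = Real.exp (rate * s) * H s - H 0 := by
    rw [intervalIntegral.integral_congr_ae_restrict hcongr,
      intervalIntegral.integral_eq_sub_of_hasDeriv_right_of_le hs.1
      (f := fun u => Real.exp (rate * u) * H u) (by fun_prop) ?_ (hIk.congr_ae hcongr)]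
    · rw [mul_zero, Real.exp_zero, one_mul]
    · intro u hu
      have h1 : HasDerivWithinAt (fun u => Real.exp (rate * u)) (Real.exp (rate * u) * rate)
          (Ioi u) u := by
        simpa using ((hasDerivAt_id u).const_mul rate).exp.hasDerivWithinAt
      convert! h1.mul (hd u ⟨hu.1, hu.2.trans_le hs.2⟩) using 1
      ring
  rw [integral_expMeasure hrate]
  have htail : EqOn (fun d => rate * Real.exp (-(rate * d)) * (if d < s then k (s - d) else H 0))
      (fun d => rate * H 0 * Real.exp (-rate * d)) (Ioi s) := fun d (hd : s < d) => by
    simp only [if_neg hd.not_gt, neg_mul]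
    ring
  -- On `(0, s)` the substitution `u = s - d` gives the integral evaluated in `hFTC`.
  have hhead : (fun d => rate * Real.exp (-(rate * d)) * (if d < s then k (s - d) else H 0))
      =ᵐ[volume.restrict (uIoc 0 s)] fun d =>
        Real.exp (-(rate * s)) * (rate * Real.exp (rate * (s - d)) * k (s - d)) := by
    rw [uIoc_of_le hs.1]
    filter_upwards [ae_restrict_mem measurableSet_Ioc,
      ae_restrict_of_ae (Measure.ae_ne volume s)] with d hd hds
    have he : Real.exp (-(rate * d)) = Real.exp (-(rate * s)) * Real.exp (rate * (s - d)) := by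
      rw [← Real.exp_add]; ring_nf
    rw [if_pos (lt_of_le_of_ne hd.2 hds), he]
    ring
  have hIhead : IntervalIntegrable
      (fun d => rate * Real.exp (-(rate * d)) * (if d < s then k (s - d) else H 0)) volume 0 s := by
    refine IntervalIntegrable.congr_ae ?_ hhead.symm
    have := (hIk.comp_sub_left s).symm
    rw [sub_zero, sub_self] at this
    exact this.const_mul _
  have hItail : IntegrableOn
      (fun d => rate * Real.exp (-(rate * d)) * (if d < s then k (s - d) else H 0)) (Ioi s) :=
    IntegrableOn.congr_fun ((integrableOn_exp_mul_Ioi (neg_neg_iff_pos.2 hrate) s).const_mul _)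
      htail.symm measurableSet_Ioi
  rw [← intervalIntegral.integral_interval_add_Ioi' hIhead hItail,
    setIntegral_congr_fun measurableSet_Ioi htail, integral_const_mul,
    integral_exp_mul_Ioi (neg_neg_iff_pos.2 hrate),
    intervalIntegral.integral_congr_ae_restrict hhead, intervalIntegral.integral_const_mul,
    intervalIntegral.integral_comp_sub_left (fun u => rate * Real.exp (rate * u) * k u), sub_zero,
    sub_self, hFTC, Real.exp_neg, neg_mul, Real.exp_neg]
  field_simp
  ring

/-! ### The past, independence, and the time left -/

lemma expMeasure_Iic_lt_one {rate : ℝ} (hrate : 0 < rate) (t : ℝ) :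
    expMeasure rate (Iic t) < 1 := by
  have := isProbabilityMeasure_expMeasure hrate
  rw [← ofReal_cdf, cdf_expMeasure_eq hrate]
  split_ifs
  · rw [← ENNReal.ofReal_one, ENNReal.ofReal_lt_ofReal_iff one_pos]
    linarith [Real.exp_pos (-(rate * t))]
  · simp

lemma ae_pos_expMeasure {rate : ℝ} (hrate : 0 < rate) : ∀ᵐ d ∂(expMeasure rate), 0 < d := by
  have := isProbabilityMeasure_expMeasure hrate
  have hc := cdf_expMeasure_eq hrate 0
  rw [cdf_eq_real] at hc
  rw [ae_iff]
  simp only [not_lt]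
  change expMeasure rate (Iic 0) = 0
  simpa [measureReal_eq_zero_iff] using hc

namespace BiddingProcess

variable {Ω : Type*} [mΩ : MeasurableSpace Ω] {P : Measure Ω} {rate : ℝ} {ν ν₀ : Measure ℝ}

/-- The σ-algebra generated by the arrivals and the sizes of the offers before offer `n`. -/
@[reducible]
def past (B : BiddingProcess P rate ν ν₀) (n : ℕ) : MeasurableSpace Ω :=
  ⨆ i < n, MeasurableSpace.comap (fun ω => (B.D i ω, B.X i ω)) inferInstance

variable (B : BiddingProcess P rate ν ν₀)

lemma history_eq_past (n : ℕ) : B.history n = B.past (n + 1) := by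
  simp only [history, Filtration.natural, past, Nat.lt_succ_iff]

lemma past_mono : Monotone B.past :=
  fun _ _ h => biSup_mono fun _ hi => hi.trans_le h

lemma past_le (n : ℕ) : B.past n ≤ mΩ :=
  iSup₂_le fun i _ => ((B.measurable_D i).prodMk (B.measurable_X i)).comap_le

lemma measurable_pair_past {i n : ℕ} (h : i < n) :
    Measurable[B.past n] (fun ω => (B.D i ω, B.X i ω)) :=
  Measurable.of_comap_le (le_iSup₂_of_le i h le_rfl)

lemma measurable_D_past {i n : ℕ} (h : i < n) : Measurable[B.past n] (B.D i) :=
  measurable_fst.comp (B.measurable_pair_past h)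

lemma measurable_X_past {i n : ℕ} (h : i < n) : Measurable[B.past n] (B.X i) :=
  measurable_snd.comp (B.measurable_pair_past h)

lemma measurable_timeLeft_past (t : ℝ) (n : ℕ) : Measurable[B.past n] (B.timeLeft t n) := by
  induction n with
  | zero => exact measurable_const
  | succ n ih =>
    exact ((ih.mono (B.past_mono n.le_succ) le_rfl).sub (B.measurable_D_past n.lt_succ_self)).max
      measurable_const

lemma measurable_timeLeft (t : ℝ) (n : ℕ) : Measurable (B.timeLeft t n) :=
  (B.measurable_timeLeft_past t n).mono (B.past_le n) le_rfl

lemma measurable_sumElim (j : (ℕ ⊕ ℕ) ⊕ Unit) :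
    Measurable (Sum.elim (Sum.elim B.D B.X) (fun _ : Unit => B.X₀) j) := by
  rcases j with (i | i) | _
  exacts [B.measurable_D i, B.measurable_X i, B.measurable_X₀]

lemma comap_pair (i : ℕ) :
    MeasurableSpace.comap (fun ω => (B.D i ω, B.X i ω)) inferInstance =
      MeasurableSpace.comap (B.D i) inferInstance ⊔ MeasurableSpace.comap (B.X i) inferInstance :=
  MeasurableSpace.comap_prodMk _ _

lemma indep_past_pair (n : ℕ) :
    Indep (B.past n) (MeasurableSpace.comap (fun ω => (B.D n ω, B.X n ω)) inferInstance) P := by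
  have h := indep_iSup_of_disjoint (fun j => (B.measurable_sumElim j).comap_le) B.indep
    (S := {j | ∃ i < n, j = Sum.inl (Sum.inl i) ∨ j = Sum.inl (Sum.inr i)})
    (T := {Sum.inl (Sum.inl n), Sum.inl (Sum.inr n)}) (by
      rw [Set.disjoint_left]
      rintro _ ⟨i, hi, rfl | rfl⟩ h <;> simp at h <;> omega)
  refine indep_of_indep_of_le_left (indep_of_indep_of_le_right h ?_) ?_
  · rw [comap_pair]
    exact sup_le (le_iSup₂_of_le (Sum.inl (Sum.inl n)) (by simp) le_rfl)
      (le_iSup₂_of_le (Sum.inl (Sum.inr n)) (by simp) le_rfl)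
  · refine iSup₂_le fun i hi => ?_
    rw [comap_pair]
    exact sup_le (le_iSup₂_of_le (Sum.inl (Sum.inl i)) ⟨i, hi, Or.inl rfl⟩ le_rfl)
      (le_iSup₂_of_le (Sum.inl (Sum.inr i)) ⟨i, hi, Or.inr rfl⟩ le_rfl)

lemma indep_iSup_past_X₀ :
    Indep (⨆ n, B.past n) (MeasurableSpace.comap B.X₀ inferInstance) P := by
  have h := indep_iSup_of_disjoint (fun j => (B.measurable_sumElim j).comap_le) B.indep
    (S := range Sum.inl) (T := {Sum.inr ()}) (by
      rw [Set.disjoint_left]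
      rintro _ ⟨i, rfl⟩ h; simp at h)
  refine indep_of_indep_of_le_left (indep_of_indep_of_le_right h ?_) ?_
  · exact le_iSup₂_of_le (Sum.inr ()) (by simp) le_rfl
  · refine iSup_le fun n => iSup₂_le fun i hi => ?_
    rw [comap_pair]
    exact sup_le (le_iSup₂_of_le (Sum.inl (Sum.inl i)) (by simp) le_rfl)
      (le_iSup₂_of_le (Sum.inl (Sum.inr i)) (by simp) le_rfl)

lemma map_pair [IsProbabilityMeasure P] (n : ℕ) :
    P.map (fun ω => (B.D n ω, B.X n ω)) = (expMeasure rate).prod ν := by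
  have h : IndepFun (B.D n) (B.X n) P :=
    B.indep.indepFun (i := Sum.inl (Sum.inl n)) (j := Sum.inl (Sum.inr n)) (by simp)
  have h2 := (indepFun_iff_map_prod_eq_prod_map_map (B.measurable_D n).aemeasurable
    (B.measurable_X n).aemeasurable).1 h
  rwa [B.map_D n, B.map_X n] at h2

lemma ae_D_pos (hrate : 0 < rate) : ∀ᵐ ω ∂P, ∀ n, 0 < B.D n ω := by
  rw [ae_all_iff]
  intro n
  have h := ae_pos_expMeasure hrate
  rw [← B.map_D n] at h
  exact ae_of_ae_map (B.measurable_D n).aemeasurable h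

variable {B} in
lemma timeLeft_mem_Icc {t : ℝ} (ht : 0 ≤ t) {ω : Ω} (hω : ∀ n, 0 < B.D n ω) (n : ℕ) :
    B.timeLeft t n ω ∈ Icc 0 t := by
  induction n with
  | zero => exact ⟨ht, le_rfl⟩
  | succ n ih => exact ⟨le_max_right _ _, max_le (by linarith [hω n, ih.2]) ht⟩

variable {B} in
lemma timeLeft_antitone {t : ℝ} (ht : 0 ≤ t) {ω : Ω} (hω : ∀ n, 0 < B.D n ω) :
    Antitone fun n => B.timeLeft t n ω :=
  antitone_nat_of_succ_le fun n =>
    max_le (by linarith [hω n]) (timeLeft_mem_Icc ht hω n).1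

/-- If time is left after `n` arrivals, then the first `n` durations are all at most `t`. -/
lemma measure_timeLeft_pos_le [IsProbabilityMeasure P] (hrate : 0 < rate) {t : ℝ} (ht : 0 ≤ t)
    (n : ℕ) : P {ω | 0 < B.timeLeft t n ω} ≤ (expMeasure rate (Iic t)) ^ n := by
  have hD : iIndepFun B.D P := B.indep.precomp
    (g := fun i : ℕ => (Sum.inl (Sum.inl i) : (ℕ ⊕ ℕ) ⊕ Unit)) (fun i j h => by simpa using h)
  have h := hD.measure_inter_preimage_eq_mul (Finset.range n) (sets := fun _ => Iic t)
    (fun _ _ => measurableSet_Iic)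
  calc P {ω | 0 < B.timeLeft t n ω} ≤ P (⋂ i ∈ Finset.range n, B.D i ⁻¹' Iic t) := by
        refine measure_mono_ae ?_
        filter_upwards [B.ae_D_pos hrate] with ω hω hn
        have hn : 0 < B.timeLeft t n ω := hn
        refine mem_iInter₂.2 fun i hi => ?_
        have h1 : 0 < B.timeLeft t (i + 1) ω :=
          hn.trans_le (timeLeft_antitone ht hω (Finset.mem_range.1 hi))
        have h2 : 0 < B.timeLeft t i ω - B.D i ω := by
          simpa [timeLeft] using h1
        have h3 := (timeLeft_mem_Icc ht hω i).2
        exact le_of_lt (show B.D i ω < t by linarith)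
    _ = _ := by
        rw [h, Finset.prod_congr rfl (g := fun _ => expMeasure rate (Iic t))]
        · simp
        · intro i _
          rw [← B.map_D i, Measure.map_apply (B.measurable_D i) measurableSet_Iic]

lemma ae_exists_timeLeft_eq_zero [IsProbabilityMeasure P] (hrate : 0 < rate) {t : ℝ}
    (ht : 0 ≤ t) : ∀ᵐ ω ∂P, ∃ n, B.timeLeft t n ω = 0 := by
  have h0 : P {ω | ∀ n, 0 < B.timeLeft t n ω} = 0 := by
    refine le_antisymm ?_ bot_le
    refine ge_of_tendsto' (ENNReal.tendsto_pow_atTop_nhds_zero_of_lt_one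
      (expMeasure_Iic_lt_one hrate t)) fun n => ?_
    exact (measure_mono fun ω (hω : ∀ n, 0 < B.timeLeft t n ω) => hω n).trans
      (B.measure_timeLeft_pos_le hrate ht n)
  have h1 : ∀ᵐ ω ∂P, ¬ ∀ n, 0 < B.timeLeft t n ω := by
    rw [ae_iff]; simpa using h0
  filter_upwards [h1, B.ae_D_pos hrate] with ω hω hD
  push Not at hω
  obtain ⟨n, hn⟩ := hω
  exact ⟨n, le_antisymm hn (timeLeft_mem_Icc ht hD n).1⟩

end BiddingProcess

/-! ### The verification theorem -/

/-- Integrating out an independent variable. -/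
lemma ProbabilityTheory.IndepFun.integral_comp_eq {Ω 𝒰 𝒱 : Type*} [MeasurableSpace Ω]
    [MeasurableSpace 𝒰] [MeasurableSpace 𝒱] {P : Measure Ω} [IsProbabilityMeasure P]
    {U : Ω → 𝒰} {V : Ω → 𝒱} (h : IndepFun U V P) (hU : Measurable U) (hV : Measurable V)
    {f : 𝒰 × 𝒱 → ℝ} (hf : Measurable f) (hint : Integrable (fun ω => f (U ω, V ω)) P) :
    ∫ ω, f (U ω, V ω) ∂P = ∫ ω, ∫ v, f (U ω, v) ∂(P.map V) ∂P := by
  have := Measure.isProbabilityMeasure_map (μ := P) hV.aemeasurable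
  have := Measure.isProbabilityMeasure_map (μ := P) hU.aemeasurable
  have hmap := (indepFun_iff_map_prod_eq_prod_map_map hU.aemeasurable hV.aemeasurable).1 h
  have hint' : Integrable f ((P.map U).prod (P.map V)) := by
    rw [← hmap]
    exact (integrable_map_measure hf.aestronglyMeasurable (hU.prodMk hV).aemeasurable).2 hint
  rw [← integral_map (f := f) (hU.prodMk hV).aemeasurable hf.aestronglyMeasurable, hmap,
    integral_prod f hint', integral_map hU.aemeasurable]
  exact (hf.stronglyMeasurable.integral_prod_right').aestronglyMeasurable

lemma WithTop.natCast_succ_le_iff {n : ℕ} {x : WithTop ℕ} :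
    ((n + 1 : ℕ) : WithTop ℕ) ≤ x ↔ (n : WithTop ℕ) < x := by
  cases x with
  | top => simp
  | coe k => exact WithTop.coe_le_coe.trans (Nat.succ_le_iff.trans WithTop.coe_lt_coe.symm)

lemma WithTop.untopD_of_eq_natCast {n : ℕ} {x : WithTop ℕ} (h : x = n) : x.untopD 0 = n := by
  rw [h]; rfl

namespace BiddingProcess

variable {Ω : Type*} [mΩ : MeasurableSpace Ω] {P : Measure Ω} {rate : ℝ} {ν ν₀ : Measure ℝ}
variable (B : BiddingProcess P rate ν ν₀)

/-- The Markov property: given the past, the next arrival and the next offer have their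
unconditional joint law, and only the time left matters. -/
lemma setIntegral_next [IsProbabilityMeasure P] {t : ℝ} {n : ℕ} {A : Set Ω}
    (hA : MeasurableSet[B.past n] A) {Z : ℝ × ℝ × ℝ → ℝ} (hZ : Measurable Z)
    (hint : Integrable (fun ω => Z (B.timeLeft t n ω, B.D n ω, B.X n ω)) P) :
    ∫ ω in A, Z (B.timeLeft t n ω, B.D n ω, B.X n ω) ∂P =
      ∫ ω in A, ∫ p, Z (B.timeLeft t n ω, p) ∂((expMeasure rate).prod ν) ∂P := by
  have hA' := B.past_le n A hA
  -- The indicator of `A` is carried along as a coordinate that is independent of the next pair.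
  set U : Ω → ℝ × ℝ := fun ω => (A.indicator (fun _ => 1) ω, B.timeLeft t n ω) with hU
  have hUm : Measurable[B.past n] U :=
    (measurable_const.indicator hA).prodMk (B.measurable_timeLeft_past t n)
  have hVm := (B.measurable_D n).prodMk (B.measurable_X n)
  have hind : IndepFun U (fun ω => (B.D n ω, B.X n ω)) P :=
    indep_of_indep_of_le_left (B.indep_past_pair n) hUm.comap_le
  have key := hind.integral_comp_eq (hUm.mono (B.past_le n) le_rfl) hVm
    (f := fun q => q.1.1 * Z (q.1.2, q.2)) (by fun_prop) ?_
  · rw [B.map_pair n] at key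
    rw [← integral_indicator hA', ← integral_indicator hA']
    simp only [integral_const_mul, hU] at key
    have e : ∀ (g : Ω → ℝ) ω, A.indicator (fun _ => (1 : ℝ)) ω * g ω = A.indicator g ω := by
      intro g ω
      by_cases h : ω ∈ A <;> simp [h]
    have e1 := e fun ω => Z (B.timeLeft t n ω, B.D n ω, B.X n ω)
    have e2 := e fun ω => ∫ p, Z (B.timeLeft t n ω, p) ∂((expMeasure rate).prod ν)
    simpa only [e1, e2] using key
  · refine (hint.indicator hA').congr (ae_of_all _ fun ω => ?_)
    by_cases h : ω ∈ A <;> simp [hU, h]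

lemma integrable_posPart_X (hν : Integrable (fun x : ℝ => max x 0) ν) (n : ℕ) :
    Integrable (fun ω => max (B.X n ω) 0) P := by
  rw [← B.map_X n] at hν
  exact (integrable_map_measure (by fun_prop) (B.measurable_X n).aemeasurable).1 hν

lemma measurableSet_past_natCast_le {τ : Ω → WithTop ℕ} (hτ : IsStoppingTime B.history τ) (n : ℕ) :
    MeasurableSet[B.past n] {ω | (n : WithTop ℕ) ≤ τ ω} := by
  cases n with
  | zero => simp
  | succ n =>
    have h := (hτ n).compl
    rw [history_eq_past] at h
    convert! h using 1
    ext ω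
    simpa using WithTop.natCast_succ_le_iff

/-- The verification theorem. Let `R` be the reward of the stopping rule `τ`, and let `Z (s, d, x)`
dominate, when time `s` is left, the next arrival takes time `d` and the next offer is `x`, the
reward if the rule stops there, and the value `H` at the new time left if it continues. If the mean
of `Z (s, ·)` is at most `H s` for all `s`, then the mean of `R` is at most `H t`: the process
that is `R` after stopping and `H` of the time left before stopping is a supermartingale. -/
theorem integral_le_of_supersolution [IsProbabilityMeasure P] [IsProbabilityMeasure ν]
    (hrate : 0 < rate) (hν : Integrable (fun x : ℝ => max x 0) ν) {t : ℝ} (ht : 0 ≤ t)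
    {τ : Ω → WithTop ℕ} (hτ : IsStoppingTime B.history τ) {R : Ω → ℝ} (hR : Integrable R P)
    {H : ℝ → ℝ} (hH : Measurable H) {Z : ℝ × ℝ × ℝ → ℝ} (hZ : Measurable Z) {C : ℝ}
    (hHC : ∀ s ∈ Icc 0 t, |H s| ≤ C)
    (hZC : ∀ s ∈ Icc 0 t, ∀ d, 0 < d → ∀ x, |Z (s, d, x)| ≤ C + max x 0)
    (hstep : ∀ s ∈ Icc 0 t, ∫ p, Z (s, p) ∂((expMeasure rate).prod ν) ≤ H s)
    (hsell : ∀ ω, (∀ k, 0 < B.D k ω) → ∀ n : ℕ, τ ω = n →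
      R ω ≤ Z (B.timeLeft t n ω, B.D n ω, B.X n ω))
    (hcont : ∀ ω, (∀ k, 0 < B.D k ω) → ∀ n : ℕ, (n : WithTop ℕ) < τ ω →
      H (B.timeLeft t (n + 1) ω) ≤ Z (B.timeLeft t n ω, B.D n ω, B.X n ω))
    (hend : ∀ ω, (∀ k, 0 < B.D k ω) → ∀ n : ℕ, (n : WithTop ℕ) ≤ τ ω → B.timeLeft t n ω = 0 →
      R ω = H 0) :
    ∫ ω, R ω ∂P ≤ H t := by
  have hD := B.ae_D_pos hrate
  have := isProbabilityMeasure_expMeasure hrate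
  set A : ℕ → Set Ω := fun n => {ω | (n : WithTop ℕ) ≤ τ ω} with hAdef
  have hA : ∀ n, MeasurableSet[B.past n] (A n) := B.measurableSet_past_natCast_le hτ
  have hA' : ∀ n, MeasurableSet (A n) := fun n => B.past_le n _ (hA n)
  have hHi : ∀ n, Integrable (fun ω => H (B.timeLeft t n ω)) P := fun n =>
    Integrable.of_bound (hH.comp (B.measurable_timeLeft t n)).aestronglyMeasurable C <| by
      filter_upwards [hD] with ω hω
      exact hHC _ (timeLeft_mem_Icc ht hω n)
  have hZi : ∀ n, Integrable (fun ω => Z (B.timeLeft t n ω, B.D n ω, B.X n ω)) P := fun n => by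
    refine ((integrable_const C).add (B.integrable_posPart_X hν n)).mono'
      (hZ.comp ((B.measurable_timeLeft t n).prodMk
        ((B.measurable_D n).prodMk (B.measurable_X n)))).aestronglyMeasurable ?_
    filter_upwards [hD] with ω hω
    exact hZC _ (timeLeft_mem_Icc ht hω n) _ (hω n) _
  have hZint : ∀ n, Integrable
      (fun ω => ∫ p, Z (B.timeLeft t n ω, p) ∂((expMeasure rate).prod ν)) P := fun n => by
    refine Integrable.of_bound (hZ.stronglyMeasurable.integral_prod_right'.comp_measurable
      (B.measurable_timeLeft t n)).aestronglyMeasurable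
      (∫ p : ℝ × ℝ, (C + max p.2 0) ∂((expMeasure rate).prod ν)) ?_
    filter_upwards [hD] with ω hω
    refine norm_integral_le_of_norm_le ((integrable_const C).add (hν.comp_snd _)) ?_
    filter_upwards [Measure.quasiMeasurePreserving_fst.ae (ae_pos_expMeasure hrate)] with p hp
    exact hZC _ (timeLeft_mem_Icc ht hω n) _ hp _
  -- `W n` is the supermartingale: the reward if the sale is made before offer `n`, and otherwise
  -- the value of the time left.
  set W : ℕ → Ω → ℝ := fun n ω =>
    (A n).indicator (fun ω => H (B.timeLeft t n ω)) ω + (A n)ᶜ.indicator R ω with hW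
  have hWi : ∀ n, Integrable (W n) P := fun n =>
    ((hHi n).indicator (hA' n)).add (hR.indicator (hA' n).compl)
  have hdecr : ∀ n, ∫ ω, W (n + 1) ω ∂P ≤ ∫ ω, W n ω ∂P := by
    intro n
    calc ∫ ω, W (n + 1) ω ∂P
        ≤ ∫ ω, ((A n).indicator (fun ω => Z (B.timeLeft t n ω, B.D n ω, B.X n ω)) ω +
            (A n)ᶜ.indicator R ω) ∂P := by
          refine integral_mono_ae (hWi _)
            (((hZi n).indicator (hA' n)).add (hR.indicator (hA' n).compl)) ?_
          filter_upwards [hD] with ω hω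
          simp only [hW]
          by_cases h : ω ∈ A (n + 1)
          · have h' : (n : WithTop ℕ) < τ ω :=
              WithTop.natCast_succ_le_iff.1 h
            have h'' : ω ∈ A n := h'.le
            simpa [h, h''] using hcont ω hω n h'
          · by_cases h'' : ω ∈ A n
            · have h' : τ ω = n := le_antisymm (not_lt.1 fun h' =>
                h (WithTop.natCast_succ_le_iff.2 h')) h''
              simpa [h, h''] using hsell ω hω n h'
            · simp [h, h'']
      _ = ∫ ω in A n, Z (B.timeLeft t n ω, B.D n ω, B.X n ω) ∂P +
            ∫ ω, (A n)ᶜ.indicator R ω ∂P := by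
          rw [integral_add ((hZi n).indicator (hA' n)) (hR.indicator (hA' n).compl),
            integral_indicator (hA' n)]
      _ ≤ ∫ ω in A n, H (B.timeLeft t n ω) ∂P + ∫ ω, (A n)ᶜ.indicator R ω ∂P := by
          gcongr 1
          rw [B.setIntegral_next (hA n) hZ (hZi n)]
          refine setIntegral_mono_ae ?_ (hHi n).integrableOn ?_
          · exact (hZint n).integrableOn
          · filter_upwards [hD] with ω hω
            exact hstep _ (timeLeft_mem_Icc ht hω n)
      _ = ∫ ω, W n ω ∂P := by
          rw [← integral_indicator (hA' n),
            ← integral_add ((hHi n).indicator (hA' n)) (hR.indicator (hA' n).compl)]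
  have hle : ∀ n, ∫ ω, W n ω ∂P ≤ H t := by
    intro n
    induction n with
    | zero => simp [hW, hAdef, timeLeft]
    | succ n ih => exact (hdecr n).trans ih
  have hlim : Filter.Tendsto (fun n => ∫ ω, W n ω ∂P) Filter.atTop (nhds (∫ ω, R ω ∂P)) := by
    refine tendsto_integral_of_dominated_convergence (fun ω => C + |R ω|)
      (fun n => (hWi n).aestronglyMeasurable) ((integrable_const C).add hR.abs) (fun n => ?_) ?_
    · filter_upwards [hD] with ω hω
      have hC := (abs_nonneg _).trans (hHC _ (timeLeft_mem_Icc ht hω n))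
      have := hHC _ (timeLeft_mem_Icc ht hω n)
      have := abs_nonneg (R ω)
      rw [Real.norm_eq_abs]
      by_cases h : ω ∈ A n <;> simp [hW, h] <;> linarith
    · filter_upwards [hD, B.ae_exists_timeLeft_eq_zero hrate ht] with ω hω ⟨N, hN⟩
      -- From the time on at which the deadline is reached, `W n` is the reward.
      refine tendsto_const_nhds.congr' ?_
      filter_upwards [Filter.eventually_ge_atTop N] with n hn
      have h0 : B.timeLeft t n ω = 0 :=
        le_antisymm (hN ▸ timeLeft_antitone ht hω hn) (timeLeft_mem_Icc ht hω n).1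
      by_cases h : ω ∈ A n
      · simp [hW, h, h0, hend ω hω n h h0]
      · simp [hW, h]
  exact le_of_tendsto' hlim hle

end BiddingProcess

/-! ### Stopping rules, rewards and threshold rules -/

namespace BiddingProcess

variable {Ω : Type*} [mΩ : MeasurableSpace Ω] {P : Measure Ω} {rate : ℝ} {ν ν₀ : Measure ℝ}
variable (B : BiddingProcess P rate ν ν₀)

/-- The event that the rule `τ` sells the asset before the deadline. -/
def soldEarly (t : ℝ) (τ : Ω → WithTop ℕ) : Set Ω :=
  {ω | τ ω ≠ ⊤ ∧ 0 < B.timeLeft t ((τ ω).untopD 0 + 1) ω}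

/-- The function `g` of the sale price under the rule `τ`, averaged over the residual price. -/
noncomputable def reward (t : ℝ) (τ : Ω → WithTop ℕ) (g : ℝ → ℝ) (ω : Ω) : ℝ :=
  open Classical in
  if ω ∈ B.soldEarly t τ then g (B.X ((τ ω).untopD 0) ω) else ∫ x, g x ∂ν₀

variable {B}

lemma measurableSet_past_eq_natCast {τ : Ω → WithTop ℕ} (hτ : IsStoppingTime B.history τ) (n : ℕ) :
    MeasurableSet[B.past (n + 1)] {ω | τ ω = n} := by
  have h1 := B.past_mono n.le_succ _ (B.measurableSet_past_natCast_le hτ n)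
  have h2 := B.measurableSet_past_natCast_le hτ (n + 1)
  convert! h1.diff h2 using 1
  ext ω
  have := WithTop.natCast_succ_le_iff (n := n) (x := τ ω)
  rw [mem_sdiff]
  change τ ω = n ↔ (n : WithTop ℕ) ≤ τ ω ∧ ¬ ((n + 1 : ℕ) : WithTop ℕ) ≤ τ ω
  rw [this, not_lt, le_antisymm_iff, and_comm]

lemma soldEarly_eq_iUnion (t : ℝ) (τ : Ω → WithTop ℕ) :
    B.soldEarly t τ = ⋃ n : ℕ, {ω | τ ω = n} ∩ {ω | 0 < B.timeLeft t (n + 1) ω} := by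
  ext ω
  simp only [soldEarly, mem_iUnion]
  constructor
  · rintro ⟨h1, h2⟩
    refine ⟨(τ ω).untopD 0, ?_, h2⟩
    change τ ω = _
    cases h : τ ω with
    | top => exact absurd h h1
    | coe k => rfl
  · rintro ⟨n, h1, h2⟩
    have h1 : τ ω = n := h1
    refine ⟨by simp [h1], ?_⟩
    have : (τ ω).untopD 0 = n := by rw [h1]; rfl
    rw [this]
    exact h2

lemma measurableSet_soldEarly_past {τ : Ω → WithTop ℕ} (hτ : IsStoppingTime B.history τ) (t : ℝ) :
    MeasurableSet[⨆ n, B.past n] (B.soldEarly t τ) := by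
  rw [soldEarly_eq_iUnion]
  refine MeasurableSet.iUnion fun n => ?_
  refine le_iSup B.past (n + 1) _ ((measurableSet_past_eq_natCast hτ n).inter ?_)
  exact measurableSet_lt measurable_const (B.measurable_timeLeft_past t (n + 1))

lemma measurableSet_soldEarly {τ : Ω → WithTop ℕ} (hτ : IsStoppingTime B.history τ) (t : ℝ) :
    MeasurableSet (B.soldEarly t τ) :=
  iSup_le B.past_le _ (measurableSet_soldEarly_past hτ t)

lemma measurable_X_untopD {τ : Ω → WithTop ℕ} (hτ : IsStoppingTime B.history τ) :
    Measurable fun ω => B.X ((τ ω).untopD 0) ω := by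
  have h1 : Measurable fun ω => (τ ω).untopD 0 := by
    refine measurable_to_countable' fun n => ?_
    have heq : ∀ k : ℕ, MeasurableSet {ω | τ ω = k} :=
      fun k => B.past_le _ _ (measurableSet_past_eq_natCast hτ k)
    have : (fun ω => (τ ω).untopD 0) ⁻¹' {n} =
        {ω | τ ω = n} ∪ {ω | n = 0} ∩ (⋃ k : ℕ, {ω | τ ω = k})ᶜ := by
      ext ω
      cases h : τ ω with
      | top => simp [h, eq_comm]
      | coe k =>
        have : ω ∈ ⋃ k : ℕ, {ω | τ ω = k} := mem_iUnion.2 ⟨k, h⟩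
        simp only [mem_preimage, mem_singleton_iff, mem_union, mem_inter_iff, mem_compl_iff, this,
          not_true_eq_false, and_false, or_false]
        change (τ ω).untopD 0 = n ↔ τ ω = (n : WithTop ℕ)
        rw [h]
        exact WithTop.coe_inj.symm
    rw [this]
    exact (heq n).union ((MeasurableSet.const _).inter (MeasurableSet.iUnion heq).compl)
  exact (measurable_from_prod_countable_right
    (f := fun q : ℕ × Ω => B.X q.1 q.2) B.measurable_X).comp (h1.prodMk measurable_id)

lemma payoff_of_mem {t : ℝ} {τ : Ω → WithTop ℕ} {ω : Ω} (h : ω ∈ B.soldEarly t τ) :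
    B.payoff t τ ω = B.X ((τ ω).untopD 0) ω := if_pos h

lemma payoff_of_notMem {t : ℝ} {τ : Ω → WithTop ℕ} {ω : Ω} (h : ω ∉ B.soldEarly t τ) :
    B.payoff t τ ω = B.X₀ ω := if_neg h

lemma reward_of_mem {t : ℝ} {τ : Ω → WithTop ℕ} {g : ℝ → ℝ} {ω : Ω} (h : ω ∈ B.soldEarly t τ) :
    B.reward t τ g ω = g (B.X ((τ ω).untopD 0) ω) := if_pos h

lemma reward_of_notMem {t : ℝ} {τ : Ω → WithTop ℕ} {g : ℝ → ℝ} {ω : Ω}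
    (h : ω ∉ B.soldEarly t τ) : B.reward t τ g ω = ∫ x, g x ∂ν₀ := if_neg h

lemma measurable_payoff {τ : Ω → WithTop ℕ} (hτ : IsStoppingTime B.history τ) (t : ℝ) :
    Measurable (B.payoff t τ) := by
  classical
  have : B.payoff t τ = (B.soldEarly t τ).piecewise
      (fun ω => B.X ((τ ω).untopD 0) ω) B.X₀ := by
    ext ω
    by_cases h : ω ∈ B.soldEarly t τ
    · simp [payoff_of_mem h, h]
    · simp [payoff_of_notMem h, h]
  rw [this]
  exact Measurable.piecewise (measurableSet_soldEarly hτ t) (measurable_X_untopD hτ)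
    B.measurable_X₀

/-- The residual price is independent of the decisions of the seller, so that it may be replaced
by its mean. -/
lemma integrable_reward_and_integral_eq [IsProbabilityMeasure P] {τ : Ω → WithTop ℕ}
    (hτ : IsStoppingTime B.history τ) {t : ℝ} {g : ℝ → ℝ} (hg : Measurable g)
    (hg₀ : Integrable g ν₀) (hint : Integrable (fun ω => g (B.payoff t τ ω)) P) :
    Integrable (B.reward t τ g) P ∧
      ∫ ω, B.reward t τ g ω ∂P = ∫ ω, g (B.payoff t τ ω) ∂P := by
  set A := B.soldEarly t τ with hA
  have hAm : MeasurableSet A := measurableSet_soldEarly hτ t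
  have hAm' : MeasurableSet[⨆ n, B.past n] A := measurableSet_soldEarly_past hτ t
  set c := ∫ x, g x ∂ν₀ with hc
  have hX₀ : Integrable (fun ω => g (B.X₀ ω)) P := by
    rw [← B.map_X₀] at hg₀
    exact (integrable_map_measure hg.aestronglyMeasurable B.measurable_X₀.aemeasurable).1 hg₀
  set F : Ω → ℝ := A.indicator fun ω => g (B.payoff t τ ω) with hF
  have e1 : ∀ ω, g (B.payoff t τ ω) = F ω + Aᶜ.indicator (fun ω => g (B.X₀ ω)) ω := by
    intro ω
    by_cases h : ω ∈ A
    · simp [hF, h]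
    · simp [hF, h, payoff_of_notMem h]
  have e2 : ∀ ω, B.reward t τ g ω = F ω + Aᶜ.indicator (fun _ => c) ω := by
    intro ω
    by_cases h : ω ∈ A
    · simp [hF, h, payoff_of_mem h, reward_of_mem h]
    · simp [hF, h, reward_of_notMem h, hc]
  have hiF : Integrable F P := hint.indicator hAm
  have hic : Integrable (Aᶜ.indicator fun _ => c) P := (integrable_const c).indicator hAm.compl
  refine ⟨(hiF.add hic).congr (ae_of_all _ fun ω => (e2 ω).symm), ?_⟩
  rw [integral_congr_ae (ae_of_all _ e1), integral_congr_ae (ae_of_all _ e2), integral_add hiF hic,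
    integral_add hiF (hX₀.indicator hAm.compl)]
  congr 1
  set U : Ω → ℝ := Aᶜ.indicator fun _ => 1 with hU
  have hUm : Measurable[⨆ n, B.past n] U := measurable_const.indicator hAm'.compl
  have hind : IndepFun U B.X₀ P := indep_of_indep_of_le_left B.indep_iSup_past_X₀ hUm.comap_le
  have e : ∀ (f : Ω → ℝ) ω, U ω * f ω = Aᶜ.indicator f ω := by
    intro f ω
    by_cases h : ω ∈ A <;> simp [hU, h]
  have key := hind.integral_comp_eq (hUm.mono (iSup_le B.past_le) le_rfl) B.measurable_X₀
    (f := fun q => q.1 * g q.2) (by fun_prop)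
    ((hX₀.indicator hAm.compl).congr (ae_of_all _ fun ω => (e (fun ω => g (B.X₀ ω)) ω).symm))
  simp only [integral_const_mul, B.map_X₀] at key
  have k1 := e fun ω => g (B.X₀ ω)
  have k2 := e fun _ => c
  simpa only [k1, ← hc, k2] using key.symm

/-- Once the time left is `0`, no offer is accepted any more. -/
lemma notMem_soldEarly {t : ℝ} (ht : 0 ≤ t) {τ : Ω → WithTop ℕ} {ω : Ω} (hω : ∀ k, 0 < B.D k ω)
    {n : ℕ} (hn : (n : WithTop ℕ) ≤ τ ω) (h0 : B.timeLeft t n ω = 0) :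
    ω ∉ B.soldEarly t τ := by
  rintro ⟨h1, h2⟩
  have h3 : n ≤ (τ ω).untopD 0 := by
    cases h : τ ω with
    | top => exact absurd h h1
    | coe k =>
      rw [h] at hn
      exact WithTop.coe_le_coe.1 hn
  have h4 : B.timeLeft t ((τ ω).untopD 0 + 1) ω ≤ B.timeLeft t n ω :=
    timeLeft_antitone ht hω (h3.trans (Nat.le_succ _))
  rw [h0] at h4
  exact h2.not_ge h4

lemma timeLeft_succ_of_lt {t : ℝ} {n : ℕ} {ω : Ω} (h : B.D n ω < B.timeLeft t n ω) :
    B.timeLeft t (n + 1) ω = B.timeLeft t n ω - B.D n ω :=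
  max_eq_left (sub_nonneg.2 h.le)

lemma timeLeft_succ_of_le {t : ℝ} {n : ℕ} {ω : Ω} (h : B.timeLeft t n ω ≤ B.D n ω) :
    B.timeLeft t (n + 1) ω = 0 :=
  max_eq_right (sub_nonpos.2 h)

lemma timeLeft_succ_pos_iff {t : ℝ} {n : ℕ} {ω : Ω} :
    0 < B.timeLeft t (n + 1) ω ↔ B.D n ω < B.timeLeft t n ω := by
  simp [timeLeft]

lemma timeLeft_succ_nonneg (t : ℝ) (n : ℕ) (ω : Ω) : 0 ≤ B.timeLeft t (n + 1) ω :=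
  le_max_right _ _

lemma mem_soldEarly_iff_of_eq {t : ℝ} {τ : Ω → WithTop ℕ} {ω : Ω} {n : ℕ} (h : τ ω = n) :
    ω ∈ B.soldEarly t τ ↔ B.D n ω < B.timeLeft t n ω := by
  rw [← timeLeft_succ_pos_iff]
  change τ ω ≠ ⊤ ∧ 0 < B.timeLeft t ((τ ω).untopD 0 + 1) ω ↔ _
  rw [WithTop.untopD_of_eq_natCast h]
  simp [h]

/-- The number of the first offer that arrives before the deadline and is at least the value of
`m` at the time left on its arrival (`⊤` if there is none). -/
noncomputable def thresholdRule (B : BiddingProcess P rate ν ν₀) (t : ℝ) (m : ℝ → ℝ) (ω : Ω) :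
    WithTop ℕ :=
  open Classical in
  if h : ∃ n : ℕ, 0 < B.timeLeft t (n + 1) ω ∧ m (B.timeLeft t (n + 1) ω) ≤ B.X n ω
  then ((Nat.find h : ℕ) : WithTop ℕ) else ⊤

lemma optimalRule_eq_thresholdRule {m : ℝ → ℝ} (hm : ∀ s, 0 ≤ s → B.policy s = m s) (t : ℝ) :
    B.optimalRule t = B.thresholdRule t m := by
  have key : ∀ (p q : ℕ → Prop) [DecidablePred p] [DecidablePred q] [Decidable (∃ n, p n)]
      [Decidable (∃ n, q n)], p = q →
      (if h : ∃ n, p n then ((Nat.find h : ℕ) : WithTop ℕ) else ⊤) =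
        if h : ∃ n, q n then ((Nat.find h : ℕ) : WithTop ℕ) else ⊤ := by
    rintro p _ _ _ _ _ rfl
    congr!
  ext1 ω
  have hp : (fun n => 0 < B.timeLeft t (n + 1) ω ∧ B.policy (B.timeLeft t (n + 1) ω) ≤ B.X n ω) =
      fun n => 0 < B.timeLeft t (n + 1) ω ∧ m (B.timeLeft t (n + 1) ω) ≤ B.X n ω := by
    funext n
    rw [hm _ (timeLeft_succ_nonneg t _ ω)]
  unfold optimalRule thresholdRule
  classical exact key _ _ hp

lemma le_thresholdRule_iff {t : ℝ} {m : ℝ → ℝ} {n : ℕ} {ω : Ω} :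
    (n : WithTop ℕ) ≤ B.thresholdRule t m ω ↔
      ∀ k < n, ¬ (0 < B.timeLeft t (k + 1) ω ∧ m (B.timeLeft t (k + 1) ω) ≤ B.X k ω) := by
  classical
  unfold thresholdRule
  split_ifs with h
  · rw [Nat.cast_le]
    simp only [Nat.le_find_iff]
  · push Not at h ⊢
    simpa using fun k _ => h k

lemma of_thresholdRule_eq {t : ℝ} {m : ℝ → ℝ} {n : ℕ} {ω : Ω}
    (hn : B.thresholdRule t m ω = n) :
    0 < B.timeLeft t (n + 1) ω ∧ m (B.timeLeft t (n + 1) ω) ≤ B.X n ω := by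
  by_contra hcon
  have h1 : ((n + 1 : ℕ) : WithTop ℕ) ≤ B.thresholdRule t m ω := by
    rw [le_thresholdRule_iff]
    intro k hk
    rcases Nat.lt_succ_iff_lt_or_eq.1 hk with h | rfl
    · exact le_thresholdRule_iff.1 hn.ge k h
    · exact hcon
  exact absurd (WithTop.natCast_succ_le_iff.1 h1) (hn ▸ lt_irrefl _)

lemma isStoppingTime_thresholdRule {m : ℝ → ℝ} (hm : Measurable m) (t : ℝ) :
    IsStoppingTime B.history (B.thresholdRule t m) := by
  intro n
  rw [history_eq_past]
  have : {ω | B.thresholdRule t m ω ≤ n} = ⋃ k ∈ Finset.range (n + 1),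
      {ω | 0 < B.timeLeft t (k + 1) ω ∧ m (B.timeLeft t (k + 1) ω) ≤ B.X k ω} := by
    ext ω
    have h1 := WithTop.natCast_succ_le_iff (n := n) (x := B.thresholdRule t m ω)
    have h2 : B.thresholdRule t m ω ≤ n ↔ ¬ ((n + 1 : ℕ) : WithTop ℕ) ≤ B.thresholdRule t m ω := by
      rw [h1, not_lt]
    change B.thresholdRule t m ω ≤ n ↔ _
    rw [h2, le_thresholdRule_iff]
    push Not
    simp only [mem_iUnion, Finset.mem_range, exists_prop]
    rfl
  change MeasurableSet[B.past (n + 1)] {ω | B.thresholdRule t m ω ≤ (Nat.cast n : WithTop ℕ)}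
  rw [this]
  refine Finset.measurableSet_biUnion _ fun k hk => ?_
  have hk : k + 1 ≤ n + 1 := Finset.mem_range.1 hk
  have hT : Measurable[B.past (n + 1)] (B.timeLeft t (k + 1)) :=
    (B.measurable_timeLeft_past t (k + 1)).mono (B.past_mono hk) le_rfl
  exact (measurableSet_lt measurable_const hT).inter
    (measurableSet_le (hm.comp hT) (B.measurable_X_past hk))

end BiddingProcess

/-! ### Optimality of the threshold rule of the value function -/

/-- A function of an arrival, an independent offer and the time left before them, with a constant
value if the deadline comes first. -/
lemma integral_step_eq {rate : ℝ} (hrate : 0 < rate) {ν : Measure ℝ} [IsProbabilityMeasure ν]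
    (hν : Integrable (fun x : ℝ => max x 0) ν) {t s : ℝ} (hs : s ∈ Icc 0 t) {q : ℝ → ℝ → ℝ}
    (hq : Measurable fun p : ℝ × ℝ => q p.1 p.2) {C c : ℝ}
    (hqC : ∀ u ∈ Icc 0 t, ∀ x, |q u x| ≤ C + max x 0) (hc : |c| ≤ C) :
    ∫ p : ℝ × ℝ, (if p.1 < s then q (s - p.1) p.2 else c) ∂((expMeasure rate).prod ν) =
      ∫ d, (if d < s then ∫ x, q (s - d) x ∂ν else c) ∂(expMeasure rate) := by
  have := isProbabilityMeasure_expMeasure hrate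
  rw [integral_prod]
  · refine integral_congr_ae (ae_of_all _ fun d => ?_)
    by_cases h : d < s <;> simp [h]
  · refine ((integrable_const C).add (hν.comp_snd _)).mono' ?_ ?_
    · refine (Measurable.ite (measurableSet_lt measurable_fst measurable_const) ?_
        measurable_const).aestronglyMeasurable
      exact hq.comp ((measurable_const.sub measurable_fst).prodMk measurable_snd)
    · filter_upwards [Measure.quasiMeasurePreserving_fst.ae (ae_pos_expMeasure hrate)] with p hp
      rw [Real.norm_eq_abs]
      simp only [Pi.add_apply]
      split_ifs with h
      · exact hqC _ ⟨sub_nonneg.2 h.le, (sub_le_self _ hp.le).trans hs.2⟩ _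
      · linarith [le_max_right p.2 0]

namespace BiddingProcess

variable {Ω : Type*} [mΩ : MeasurableSpace Ω] {P : Measure Ω} [IsProbabilityMeasure P]
  {rate : ℝ} {ν ν₀ : Measure ℝ} [IsProbabilityMeasure ν] {B : BiddingProcess P rate ν ν₀}

/-- The instance of the verification theorem in which the bound for one step is `q u x` when an
offer `x` arrives with time `u` left, and `H 0` if the deadline comes first. The sign `σ = ±1`
allows for bounds from both sides. -/
lemma integral_reward_le_of_supersolution (hrate : 0 < rate)
    (hν : Integrable (fun x : ℝ => max x 0) ν) {t : ℝ} (ht : 0 ≤ t)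
    {τ : Ω → WithTop ℕ} (hτ : IsStoppingTime B.history τ) {g : ℝ → ℝ}
    (hR : Integrable (B.reward t τ g) P)
    {σ : ℝ} {H : ℝ → ℝ} (hH : Measurable H) (hH0 : H 0 = σ * ∫ x, g x ∂ν₀)
    {q : ℝ → ℝ → ℝ} (hq : Measurable fun p : ℝ × ℝ => q p.1 p.2) {C : ℝ}
    (hHC : ∀ s ∈ Icc 0 t, |H s| ≤ C) (hqC : ∀ u ∈ Icc 0 t, ∀ x, |q u x| ≤ C + max x 0)
    (hren : ∀ s ∈ Icc 0 t,
      ∫ d, (if d < s then ∫ x, q (s - d) x ∂ν else H 0) ∂(expMeasure rate) = H s)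
    (hsell : ∀ ω, ∀ n : ℕ, τ ω = n → 0 < B.timeLeft t (n + 1) ω →
      σ * g (B.X n ω) ≤ q (B.timeLeft t (n + 1) ω) (B.X n ω))
    (hcont : ∀ ω, ∀ n : ℕ, (n : WithTop ℕ) < τ ω → 0 < B.timeLeft t (n + 1) ω →
      H (B.timeLeft t (n + 1) ω) ≤ q (B.timeLeft t (n + 1) ω) (B.X n ω)) :
    σ * ∫ ω, B.reward t τ g ω ∂P ≤ H t := by
  have h0t : (0 : ℝ) ∈ Icc 0 t := ⟨le_rfl, ht⟩
  rw [← integral_const_mul]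
  refine B.integral_le_of_supersolution hrate hν ht hτ (hR.const_mul σ) hH
    (Z := fun z => if z.2.1 < z.1 then q (z.1 - z.2.1) z.2.2 else H 0) ?_ hHC ?_ ?_ ?_ ?_ ?_
  · refine Measurable.ite (measurableSet_lt (by fun_prop) (by fun_prop)) ?_ measurable_const
    exact hq.comp (f := fun z : ℝ × ℝ × ℝ => (z.1 - z.2.1, z.2.2)) (by fun_prop)
  · intro s hs d hd x
    dsimp only
    split_ifs with h
    · exact hqC _ ⟨sub_nonneg.2 h.le, (sub_le_self _ hd.le).trans hs.2⟩ _
    · linarith [le_max_right x 0, hHC 0 h0t]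
  · intro s hs
    exact ((integral_step_eq hrate hν hs hq hqC (hHC 0 h0t)).trans (hren s hs)).le
  · intro ω _ n hn
    dsimp only
    by_cases h : B.D n ω < B.timeLeft t n ω
    · rw [reward_of_mem ((mem_soldEarly_iff_of_eq hn).2 h), if_pos h,
        WithTop.untopD_of_eq_natCast hn, ← timeLeft_succ_of_lt h]
      exact hsell ω n hn (timeLeft_succ_pos_iff.2 h)
    · rw [reward_of_notMem (fun h' => h ((mem_soldEarly_iff_of_eq hn).1 h')), if_neg h, hH0]
  · intro ω _ n hn
    dsimp only
    by_cases h : B.D n ω < B.timeLeft t n ω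
    · rw [if_pos h, ← timeLeft_succ_of_lt h]
      exact hcont ω n hn (timeLeft_succ_pos_iff.2 h)
    · rw [if_neg h, timeLeft_succ_of_le (not_lt.1 h)]
  · intro ω hω n hn h0
    rw [reward_of_notMem (notMem_soldEarly ht hω hn h0), hH0]

/-- The mean reward of a threshold rule is the solution `H` of the renewal equation of the rule. -/
lemma integral_reward_thresholdRule (hrate : 0 < rate)
    (hν : Integrable (fun x : ℝ => max x 0) ν) {t : ℝ} (ht : 0 ≤ t) {m : ℝ → ℝ}
    (hm : Measurable m) {g : ℝ → ℝ} (hg : Measurable g)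
    (hR : Integrable (B.reward t (B.thresholdRule t m) g) P)
    {H : ℝ → ℝ} (hH : Measurable H) (hH0 : H 0 = ∫ x, g x ∂ν₀) {C : ℝ}
    (hHC : ∀ s ∈ Icc 0 t, |H s| ≤ C)
    (hgC : ∀ u ∈ Icc 0 t, ∀ x, m u ≤ x → |g x| ≤ C + max x 0)
    (hren : ∀ s ∈ Icc 0 t,
      ∫ d, (if d < s then ∫ x, (if m (s - d) ≤ x then g x else H (s - d)) ∂ν else H 0)
        ∂(expMeasure rate) = H s) :
    ∫ ω, B.reward t (B.thresholdRule t m) g ω ∂P = H t := by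
  have hq : Measurable fun p : ℝ × ℝ => if m p.1 ≤ p.2 then g p.2 else H p.1 :=
    Measurable.ite (measurableSet_le (by fun_prop) (by fun_prop)) (by fun_prop) (by fun_prop)
  have hqC : ∀ u ∈ Icc 0 t, ∀ x, |if m u ≤ x then g x else H u| ≤ C + max x 0 := by
    intro u hu x
    split_ifs with h
    · exact hgC u hu x h
    · linarith [hHC u hu, le_max_right x 0]
  have hτ := isStoppingTime_thresholdRule (B := B) hm t
  have hcont : ∀ ω, ∀ n : ℕ, (n : WithTop ℕ) < B.thresholdRule t m ω →
      0 < B.timeLeft t (n + 1) ω → ¬ m (B.timeLeft t (n + 1) ω) ≤ B.X n ω :=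
    fun ω n hn h0 h => le_thresholdRule_iff.1 (WithTop.natCast_succ_le_iff.2 hn) n n.lt_succ_self
      ⟨h0, h⟩
  refine le_antisymm ?_ ?_
  · have := integral_reward_le_of_supersolution hrate hν ht hτ hR (σ := 1) hH (by rw [hH0, one_mul])
      hq hHC hqC hren ?_ ?_
    · rwa [one_mul] at this
    · intro ω n hn _
      rw [if_pos (of_thresholdRule_eq hn).2, one_mul]
    · intro ω n hn h0
      rw [if_neg (hcont ω n hn h0)]
  · have := integral_reward_le_of_supersolution hrate hν ht hτ hR (σ := -1) hH.neg
      (by simp [hH0])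
      (q := fun u x => -if m u ≤ x then g x else H u) hq.neg (C := C)
      (by simpa using hHC) (by simpa using hqC) ?_ ?_ ?_
    · simpa using this
    · intro s hs
      simp only [Pi.neg_apply, integral_neg]
      rw [← hren s hs, ← integral_neg]
      refine integral_congr_ae (ae_of_all _ fun d => ?_)
      dsimp only
      split_ifs <;> rfl
    · intro ω n hn _
      simp [if_pos (of_thresholdRule_eq hn).2]
    · intro ω n hn h0
      simp [if_neg (hcont ω n hn h0)]

omit [IsProbabilityMeasure ν] in
/-- The payoff is dominated by `|X₀| + ∑ n, (X n)₊ 1{T n > 0}`, where the time left `T n` before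
offer `n` is independent of `X n`, and `P (T n > 0)` decays geometrically. -/
lemma integrable_payoff_thresholdRule (hrate : 0 < rate)
    (hν : Integrable (fun x : ℝ => max x 0) ν) (hν₀ : Integrable (fun x : ℝ => x) ν₀) {t : ℝ}
    (ht : 0 ≤ t) {m : ℝ → ℝ} (hm : Measurable m) (hm0 : ∀ s, 0 ≤ m s) :
    Integrable (B.payoff t (B.thresholdRule t m)) P := by
  have hτ := isStoppingTime_thresholdRule (B := B) hm t
  have hX₀ : Integrable B.X₀ P := by
    rw [← B.map_X₀] at hν₀
    exact (integrable_map_measure (by fun_prop) B.measurable_X₀.aemeasurable).1 hν₀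
  set F : ℕ → Ω → ENNReal := fun n ω => {ω | 0 < B.timeLeft t n ω}.indicator 1 ω *
    ENNReal.ofReal (max (B.X n ω) 0) with hF
  have hS : ∀ n, MeasurableSet {ω | 0 < B.timeLeft t n ω} := fun n =>
    measurableSet_lt measurable_const (B.measurable_timeLeft t n)
  have hS' : ∀ n, MeasurableSet[B.past n] {ω | 0 < B.timeLeft t n ω} := fun n =>
    measurableSet_lt measurable_const (B.measurable_timeLeft_past t n)
  have hFm : ∀ n, Measurable (F n) := fun n => (measurable_one.indicator (hS n)).mul
    (((B.measurable_X n).max measurable_const).ennreal_ofReal)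
  have hFint : ∀ n, ∫⁻ ω, F n ω ∂P ≤
      (expMeasure rate (Iic t)) ^ n * ∫⁻ x, ENNReal.ofReal (max x 0) ∂ν := by
    intro n
    have hind : IndepFun ({ω | 0 < B.timeLeft t n ω}.indicator (1 : Ω → ENNReal))
        (fun ω => ENNReal.ofReal (max (B.X n ω) 0)) P := by
      refine indep_of_indep_of_le_left (indep_of_indep_of_le_right (B.indep_past_pair n) ?_) ?_
      · have : (fun ω => ENNReal.ofReal (max (B.X n ω) 0)) =
          (fun p : ℝ × ℝ => ENNReal.ofReal (max p.2 0)) ∘ fun ω => (B.D n ω, B.X n ω) := rfl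
        rw [this, ← MeasurableSpace.comap_comp]
        exact MeasurableSpace.comap_mono (Measurable.comap_le (by fun_prop))
      · have h : Measurable[B.past n] ({ω | 0 < B.timeLeft t n ω}.indicator (1 : Ω → ENNReal)) :=
          Measurable.indicator measurable_const (hS' n)
        exact h.comap_le
    have h1 := lintegral_mul_eq_lintegral_mul_lintegral_of_indepFun
      (measurable_one.indicator (hS n))
      (((B.measurable_X n).max measurable_const).ennreal_ofReal) hind
    have h2 : ∫⁻ ω, ENNReal.ofReal (max (B.X n ω) 0) ∂P = ∫⁻ x, ENNReal.ofReal (max x 0) ∂ν := by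
      have := lintegral_map (μ := P) (f := fun x : ℝ => ENNReal.ofReal (max x 0)) (by fun_prop)
        (B.measurable_X n)
      rw [← this, B.map_X n]
    calc ∫⁻ ω, F n ω ∂P = _ := h1
      _ = P {ω | 0 < B.timeLeft t n ω} * ∫⁻ x, ENNReal.ofReal (max x 0) ∂ν := by
        rw [h2, lintegral_indicator_one (hS n)]
      _ ≤ _ := by gcongr; exact B.measure_timeLeft_pos_le hrate ht n
  have hsum : ∫⁻ ω, ∑' n, F n ω ∂P < ⊤ := by
    rw [lintegral_tsum fun n => (hFm n).aemeasurable]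
    refine (ENNReal.tsum_le_tsum hFint).trans_lt ?_
    rw [ENNReal.tsum_mul_right, ENNReal.tsum_geometric]
    refine ENNReal.mul_lt_top ?_ hν.lintegral_lt_top
    rw [ENNReal.inv_lt_top]
    exact tsub_pos_of_lt (expMeasure_Iic_lt_one hrate t)
  refine ⟨(measurable_payoff hτ t).aestronglyMeasurable, ?_⟩
  have hle : ∀ᵐ ω ∂P, ‖B.payoff t (B.thresholdRule t m) ω‖ₑ ≤ ‖B.X₀ ω‖ₑ + ∑' n, F n ω := by
    filter_upwards [B.ae_D_pos hrate] with ω hω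
    by_cases h : ω ∈ B.soldEarly t (B.thresholdRule t m)
    · rw [soldEarly_eq_iUnion] at h
      obtain ⟨n, hn, hn'⟩ := mem_iUnion.1 h
      have hn : B.thresholdRule t m ω = n := hn
      have hpos : 0 < B.timeLeft t n ω := (hω n).trans (timeLeft_succ_pos_iff.1 hn')
      have hX := (hm0 _).trans (of_thresholdRule_eq hn).2
      rw [← soldEarly_eq_iUnion] at h
      rw [payoff_of_mem h, WithTop.untopD_of_eq_natCast hn]
      refine le_add_left (le_trans (le_of_eq ?_) (ENNReal.le_tsum n))
      have hmem : ω ∈ {ω | 0 < B.timeLeft t n ω} := hpos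
      simp only [hF, indicator_of_mem hmem, Pi.one_apply, one_mul, max_eq_left hX]
      exact Real.enorm_of_nonneg hX
    · rw [payoff_of_notMem h]
      exact le_self_add
  refine (lintegral_mono_ae hle).trans_lt ?_
  rw [lintegral_add_left B.measurable_X₀.enorm]
  exact ENNReal.add_lt_top.2 ⟨hX₀.2, hsum⟩

/-- The maximal expected payoff is the solution of the differential equation of the value, and the
threshold rule of this solution attains it. -/
theorem policy_eq (hrate : 0 < rate) (hν : Integrable (fun x : ℝ => max x 0) ν)
    (hν₀ : Integrable (fun x : ℝ => x) ν₀) {μ₀ : ℝ} (hμ₀ : μ₀ = ∫ x, x ∂ν₀) (hμ₀0 : 0 ≤ μ₀)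
    {m : ℝ → ℝ} (hm : IsValueFunction rate ν μ₀ m) {t : ℝ} (ht : 0 ≤ t) :
    B.policy t = m t := by
  have hmc := hm.continuous
  have hm0 : ∀ s, 0 ≤ m s := fun s => hμ₀0.trans (hm.initial_le hrate hν s)
  have hmt : ∀ s ∈ Icc 0 t, |m s| ≤ m t := fun s hs => by
    rw [abs_of_nonneg (hm0 s)]; exact hm.monotone hrate hν hs.2
  have hqC : ∀ u ∈ Icc 0 t, ∀ x, |max x (m u)| ≤ m t + max x 0 := by
    intro u hu x
    have h1 := hm.monotone hrate hν hu.2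
    rw [abs_of_nonneg ((hm0 u).trans (le_max_right _ _))]
    exact max_le (by linarith [le_max_left x 0, hm0 t]) (by linarith [le_max_right x 0])
  have hm00 : m 0 = ∫ x, x ∂ν₀ := by rw [hm.eq_of_nonpos 0 le_rfl, hμ₀]
  have hren : ∀ s ∈ Icc 0 t,
      ∫ d, (if d < s then ∫ x, max x (m (s - d)) ∂ν else m 0) ∂(expMeasure rate) = m s := by
    intro s hs
    have hφc : Continuous (phi ν) := (lipschitzWith_phi hν).continuous
    have hk : Continuous fun u => m u + phi ν (m u) := by fun_prop
    obtain ⟨C, hC⟩ := isCompact_Icc.exists_bound_of_continuousOn (s := Icc 0 t) hk.continuousOn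
    simp only [integral_max_eq_add_phi hν]
    refine integral_expMeasure_eq_of_rightDeriv hrate hmc
      (k := fun u => m u + phi ν (m u)) hk.measurable hC (ae_of_all _ fun _ => rfl) ?_ hs
    intro u hu
    convert! (hm.hasDerivWithinAt u hu.1.le).mono Ioi_subset_Ici_self using 1
    ring
  refine IsGreatest.csSup_eq ⟨?_, ?_⟩
  · have hint := integrable_payoff_thresholdRule (B := B) hrate hν hν₀ ht hmc.measurable hm0
    have hτ := isStoppingTime_thresholdRule (B := B) hmc.measurable t
    obtain ⟨hR, hRint⟩ := integrable_reward_and_integral_eq hτ measurable_id' hν₀ hint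
    refine ⟨_, hτ, hint, ?_⟩
    rw [← hRint]
    symm
    refine integral_reward_thresholdRule hrate hν ht hmc.measurable measurable_id' hR
      hmc.measurable hm00 hmt ?_ ?_
    · intro u hu x hx
      have := hqC u hu x
      rwa [max_eq_left hx] at this
    · intro s hs
      rw [← hren s hs]
      congr! 4 with d
      ext x
      split_ifs with h
      · exact (max_eq_left h).symm
      · exact (max_eq_right (not_le.1 h).le).symm
  · rintro _ ⟨τ, hτ, hint, rfl⟩
    obtain ⟨hR, hRint⟩ := integrable_reward_and_integral_eq hτ measurable_id' hν₀ hint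
    have := integral_reward_le_of_supersolution hrate hν ht hτ hR (σ := 1) hmc.measurable
      (by rw [hm00, one_mul]) (q := fun u x => max x (m u)) (by fun_prop) hmt hqC hren
      (fun ω n _ _ => by rw [one_mul]; exact le_max_left _ _) (fun ω n _ _ => le_max_right _ _)
    rwa [one_mul, hRint] at this

end BiddingProcess

/-! ### The distribution function of the sale price -/

/-- The formula for the distribution function of the sale price at `x`, as a function of the value
`y` of the time left. -/
noncomputable def priceCDF (ν ν₀ : Measure ℝ) (μ₀ x y : ℝ) : ℝ :=
  phi ν y * (cdf ν₀ x / phi ν μ₀ + ∫ w in μ₀..y, max (cdf ν x - cdf ν w) 0 / phi ν w ^ 2)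

section

variable {ν : Measure ℝ} [IsProbabilityMeasure ν]

lemma phi_pos_of_le (hν : Integrable (fun x : ℝ => max x 0) ν) {x y : ℝ} (hy : 0 < phi ν y)
    (h : x ≤ y) : 0 < phi ν x := hy.trans_le (antitone_phi hν h)

lemma continuousOn_one_div_phi_sq (hν : Integrable (fun x : ℝ => max x 0) ν) {a y : ℝ}
    (hy : 0 < phi ν y) (hay : a ≤ y) : ContinuousOn (fun w => 1 / phi ν w ^ 2) (uIcc a y) := by
  rw [uIcc_of_le hay]
  refine continuousOn_const.div ((lipschitzWith_phi hν).continuous.pow 2).continuousOn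
    fun w hw => ?_
  exact (pow_pos (phi_pos_of_le hν hy hw.2) 2).ne'

lemma intervalIntegrable_priceCDF_integrand (hν : Integrable (fun x : ℝ => max x 0) ν) {a y : ℝ}
    (hy : 0 < phi ν y) (hay : a ≤ y) (x : ℝ) :
    IntervalIntegrable (fun w => max (cdf ν x - cdf ν w) 0 / phi ν w ^ 2) volume a y := by
  have h : IntervalIntegrable (fun w => max (cdf ν x - cdf ν w) 0) volume a y :=
    AntitoneOn.intervalIntegrable fun _ _ _ _ h =>
      max_le_max_right 0 (sub_le_sub_left (monotone_cdf ν h) _)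
  simpa only [mul_one_div] using h.mul_continuousOn (continuousOn_one_div_phi_sq hν hy hay)

lemma continuousOn_priceCDF (hν : Integrable (fun x : ℝ => max x 0) ν) (ν₀ : Measure ℝ) {μ₀ y : ℝ}
    (hy : 0 < phi ν y) (hay : μ₀ ≤ y) (x : ℝ) :
    ContinuousOn (priceCDF ν ν₀ μ₀ x) (Icc μ₀ y) := by
  refine (lipschitzWith_phi hν).continuous.continuousOn.mul (continuousOn_const.add ?_)
  rw [← uIcc_of_le hay]
  exact intervalIntegral.continuousOn_primitive_interval'
    (intervalIntegrable_priceCDF_integrand hν hy hay x) left_mem_uIcc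

lemma hasDerivWithinAt_priceCDF (hν : Integrable (fun x : ℝ => max x 0) ν) (ν₀ : Measure ℝ)
    {μ₀ y : ℝ} (hy : 0 < phi ν y) (hay : μ₀ ≤ y) (x : ℝ) :
    HasDerivWithinAt (priceCDF ν ν₀ μ₀ x)
      (((cdf ν y - 1) * priceCDF ν ν₀ μ₀ x y + max (cdf ν x - cdf ν y) 0) / phi ν y)
      (Ici y) y := by
  have hφm : Measurable (phi ν) := (lipschitzWith_phi hν).continuous.measurable
  have hFm := measurable_cdf ν
  have h1 : HasDerivWithinAt
      (fun u => ∫ w in μ₀..u, max (cdf ν x - cdf ν w) 0 / phi ν w ^ 2)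
      (max (cdf ν x - cdf ν y) 0 / phi ν y ^ 2) (Ici y) y := by
    refine intervalIntegral.integral_hasDerivWithinAt_right
      (intervalIntegrable_priceCDF_integrand hν hy hay x)
      (Measurable.stronglyMeasurable (by fun_prop)).stronglyMeasurableAtFilter ?_
    have hF : ContinuousWithinAt (cdf ν) (Ioi y) y :=
      ((cdf ν).right_continuous y).mono Ioi_subset_Ici_self
    exact ((continuousWithinAt_const.sub hF).max continuousWithinAt_const).div
      ((lipschitzWith_phi hν).continuous.pow 2).continuousWithinAt (pow_pos hy 2).ne'
  convert! (hasDerivWithinAt_phi hν y).mul (h1.const_add (cdf ν₀ x / phi ν μ₀)) using 1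
  rw [priceCDF]
  field_simp

/-- The antiderivative behind the piecewise form of the distribution function: the right
derivative of `1 / φ` is `(1 - F) / φ ^ 2`. -/
lemma integral_sub_cdf_div_phi_sq (hν : Integrable (fun x : ℝ => max x 0) ν) {a y : ℝ}
    (hy : 0 < phi ν y) (hay : a ≤ y) (c : ℝ) :
    ∫ w in a..y, (c - cdf ν w) / phi ν w ^ 2 =
      1 / phi ν y - 1 / phi ν a + (c - 1) * ∫ w in a..y, 1 / phi ν w ^ 2 := by
  have hI := (continuousOn_one_div_phi_sq hν hy hay).intervalIntegrable (μ := volume)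
  have hI' : IntervalIntegrable (fun w => (1 - cdf ν w) * (1 / phi ν w ^ 2)) volume a y :=
    (intervalIntegrable_one_sub_cdf ν a y).mul_continuousOn (continuousOn_one_div_phi_sq hν hy hay)
  have hpos : ∀ w ∈ Icc a y, 0 < phi ν w := fun w hw => phi_pos_of_le hν hy hw.2
  have hFTC : ∫ w in a..y, (1 - cdf ν w) * (1 / phi ν w ^ 2) = (phi ν y)⁻¹ - (phi ν a)⁻¹ := by
    refine intervalIntegral.integral_eq_sub_of_hasDeriv_right_of_le hay
      (f := fun w => (phi ν w)⁻¹)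
      ((lipschitzWith_phi hν).continuous.continuousOn.inv₀ fun w hw => (hpos w hw).ne') ?_ hI'
    intro w hw
    convert! ((hasDerivWithinAt_phi hν w).mono Ioi_subset_Ici_self).fun_inv
      (hpos w (Ioo_subset_Icc_self hw)).ne' using 1
    ring
  rw [one_div, one_div, ← hFTC, ← intervalIntegral.integral_const_mul,
    ← intervalIntegral.integral_add hI' (hI.const_mul _)]
  congr 1
  ext w
  ring

lemma measureReal_Ioc_eq (ν : Measure ℝ) [IsProbabilityMeasure ν] (y x : ℝ) :
    ν.real (Ioc y x) = max (cdf ν x - cdf ν y) 0 := by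
  conv_lhs => rw [← measure_cdf ν]
  rw [measureReal_def, StieltjesFunction.measure_Ioc, ENNReal.toReal_ofReal']

/-- The mean over an offer `z` of what happens at the threshold `y`, if `y` is not an atom. -/
lemma integral_ite_threshold {y : ℝ} (hy : ν {y} = 0) (x h : ℝ) :
    ∫ z, (if y ≤ z then (Iic x).indicator (fun _ => (1 : ℝ)) z else h) ∂ν =
      cdf ν y * h + max (cdf ν x - cdf ν y) 0 := by
  have hae : ∀ᵐ z ∂ν, z ≠ y := by
    rw [ae_iff]; simpa using hy
  have e : (fun z => if y ≤ z then (Iic x).indicator (fun _ => (1 : ℝ)) z else h) =ᵐ[ν]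
      fun z => (Iic y).indicator (fun _ => h) z + (Ioc y x).indicator (fun _ => 1) z := by
    filter_upwards [hae] with z hz
    rcases lt_or_gt_of_ne hz with h1 | h1
    · simp [h1.le, h1.not_ge]
    · by_cases h2 : z ≤ x <;> simp [h1.le, h1.not_ge, h1, h2]
  rw [integral_congr_ae e, integral_add ((integrable_const _).indicator measurableSet_Iic)
    ((integrable_const _).indicator measurableSet_Ioc),
    integral_indicator_const _ measurableSet_Iic, integral_indicator_const _ measurableSet_Ioc,
    measureReal_Ioc_eq, cdf_eq_real ν y]
  simp

end

namespace IsValueFunction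

variable {rate : ℝ} {ν : Measure ℝ} [IsProbabilityMeasure ν] {μ₀ : ℝ} {m : ℝ → ℝ}

/-- The value function is injective, so it meets the countably many atoms of `ν` at countably
many times. -/
lemma ae_measure_singleton_eq_zero (h : IsValueFunction rate ν μ₀ m) (hrate : 0 < rate)
    (hν : Integrable (fun x : ℝ => max x 0) ν) (hφ : 0 < phi ν μ₀) (T : ℝ) :
    ∀ᵐ s ∂volume.restrict (Ioc 0 T), ν {m s} = 0 := by
  have hc : {y : ℝ | 0 < ν {y}}.Countable := by
    simpa using! Measure.countable_meas_level_set_pos (μ := ν) measurable_id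
  have hinj : InjOn m (Ioc 0 T) :=
    (h.strictMonoOn hrate hν hφ).injOn.mono fun s hs => hs.1.le
  have hc' : (Ioc 0 T ∩ m ⁻¹' {y : ℝ | 0 < ν {y}}).Countable := by
    refine MapsTo.countable_of_injOn (f := m) (fun s hs => hs.2)
      (hinj.mono inter_subset_left) hc
  filter_upwards [ae_restrict_mem measurableSet_Ioc,
    ae_restrict_of_ae (hc'.ae_notMem volume)] with s hs hs'
  by_contra hne
  exact hs' ⟨hs, pos_iff_ne_zero.2 hne⟩

lemma continuous_priceCDF (h : IsValueFunction rate ν μ₀ m) (hrate : 0 < rate)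
    (hν : Integrable (fun x : ℝ => max x 0) ν) (hφ : 0 < phi ν μ₀) (ν₀ : Measure ℝ) (x : ℝ) :
    Continuous fun s => priceCDF ν ν₀ μ₀ x (m s) := by
  rw [continuous_iff_continuousAt]
  intro s
  have : ContinuousOn (fun s => priceCDF ν ν₀ μ₀ x (m s)) (Iic (s + 1)) :=
    (continuousOn_priceCDF hν ν₀ (h.phi_pos hrate hν hφ (s + 1)) (h.initial_le hrate hν _) x).comp
      h.continuous.continuousOn fun u hu => ⟨h.initial_le hrate hν u, h.monotone hrate hν hu⟩
  exact this.continuousAt (Iic_mem_nhds (lt_add_one s))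

/-- The claimed distribution function solves the renewal equation of the optimal rule. -/
lemma renewal_priceCDF (h : IsValueFunction rate ν μ₀ m) (hrate : 0 < rate)
    (hν : Integrable (fun x : ℝ => max x 0) ν) (hφ : 0 < phi ν μ₀) (ν₀ : Measure ℝ) (x : ℝ)
    {T s : ℝ} (hs : s ∈ Icc 0 T) :
    ∫ d, (if d < s then ∫ z, (if m (s - d) ≤ z then (Iic x).indicator (fun _ => (1 : ℝ)) z
      else priceCDF ν ν₀ μ₀ x (m (s - d))) ∂ν else priceCDF ν ν₀ μ₀ x (m 0)) ∂(expMeasure rate) =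
      priceCDF ν ν₀ μ₀ x (m s) := by
  have hHc := h.continuous_priceCDF hrate hν hφ ν₀ x
  have hmc := h.continuous
  set H : ℝ → ℝ := fun s => priceCDF ν ν₀ μ₀ x (m s) with hH
  obtain ⟨C, hC⟩ := isCompact_Icc.exists_bound_of_continuousOn (s := Icc 0 T) hHc.continuousOn
  have hq : Measurable fun p : ℝ × ℝ =>
      if m p.1 ≤ p.2 then (Iic x).indicator (fun _ => (1 : ℝ)) p.2 else H p.1 := by
    refine Measurable.ite (measurableSet_le (by fun_prop) (by fun_prop)) ?_ (by fun_prop)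
    exact (measurable_const.indicator measurableSet_Iic).comp measurable_snd
  refine integral_expMeasure_eq_of_rightDeriv hrate hHc
    (k := fun u => ∫ z, (if m u ≤ z then (Iic x).indicator (fun _ => (1 : ℝ)) z else H u) ∂ν)
    (k' := fun u => cdf ν (m u) * H u + max (cdf ν x - cdf ν (m u)) 0)
    (C := max C 1) hq.stronglyMeasurable.integral_prod_right'.measurable ?_ ?_ ?_ hs
  · intro u hu
    rw [← Real.norm_eq_abs]
    refine (norm_integral_le_of_norm_le_const (C := max C 1) (ae_of_all _ fun z => ?_)).trans
      (by simp)
    split_ifs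
    · by_cases hz : z ∈ Iic x <;> simp [hz]
    · exact (hC u hu).trans (le_max_left _ _)
  · filter_upwards [h.ae_measure_singleton_eq_zero hrate hν hφ T] with u hu
    rw [integral_ite_threshold hu]
  · intro u hu
    have h1 := (hasDerivWithinAt_priceCDF hν ν₀ (h.phi_pos hrate hν hφ u)
      (h.initial_le hrate hν u) x).comp u (h.hasDerivWithinAt u hu.1.le)
      fun v hv => h.monotone hrate hν hv
    convert! h1.mono Ioi_subset_Ici_self using 1
    have := (h.phi_pos hrate hν hφ u).ne'
    simp only [hH]
    field_simp
    ring

end IsValueFunction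

namespace BiddingProcess

variable {Ω : Type*} [mΩ : MeasurableSpace Ω] {P : Measure Ω} [IsProbabilityMeasure P]
  {rate : ℝ} {ν ν₀ : Measure ℝ} [IsProbabilityMeasure ν] [IsProbabilityMeasure ν₀]
  {B : BiddingProcess P rate ν ν₀}

/-- The distribution function of the price under the threshold rule of the value function. -/
theorem measureReal_payoff_thresholdRule_le (hrate : 0 < rate)
    (hν : Integrable (fun x : ℝ => max x 0) ν) {μ₀ : ℝ} (hφ : 0 < phi ν μ₀)
    {m : ℝ → ℝ} (hm : IsValueFunction rate ν μ₀ m) {t : ℝ} (ht : 0 ≤ t) (x : ℝ) :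
    P.real {ω | B.payoff t (B.thresholdRule t m) ω ≤ x} = priceCDF ν ν₀ μ₀ x (m t) := by
  set g : ℝ → ℝ := (Iic x).indicator fun _ => 1 with hg
  have hgm : Measurable g := measurable_const.indicator measurableSet_Iic
  have hg1 : ∀ z, |g z| ≤ 1 := fun z => by by_cases hz : z ∈ Iic x <;> simp [hg, hz]
  have hτ := isStoppingTime_thresholdRule (B := B) hm.continuous.measurable t
  have hS := measurable_payoff hτ t
  have hint : Integrable (fun ω => g (B.payoff t (B.thresholdRule t m) ω)) P :=
    Integrable.of_bound (hgm.comp hS).aestronglyMeasurable 1 (ae_of_all _ fun ω => hg1 _)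
  obtain ⟨hR, hRint⟩ := integrable_reward_and_integral_eq hτ hgm
    ((integrable_const (1 : ℝ)).indicator measurableSet_Iic) hint
  have hHc := hm.continuous_priceCDF hrate hν hφ ν₀ x
  obtain ⟨C, hC⟩ := isCompact_Icc.exists_bound_of_continuousOn (s := Icc 0 t) hHc.continuousOn
  have hG : ∫ ω, g (B.payoff t (B.thresholdRule t m) ω) ∂P =
      P.real {ω | B.payoff t (B.thresholdRule t m) ω ≤ x} := by
    have : (fun ω => g (B.payoff t (B.thresholdRule t m) ω)) =
        (B.payoff t (B.thresholdRule t m) ⁻¹' Iic x).indicator fun _ => 1 := rfl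
    rw [this, integral_indicator_const _ (hS measurableSet_Iic), smul_eq_mul, mul_one]
    rfl
  rw [← hG, ← hRint]
  refine integral_reward_thresholdRule hrate hν ht hm.continuous.measurable hgm hR
    (H := fun s => priceCDF ν ν₀ μ₀ x (m s)) (C := max C 1) hHc.measurable ?_ ?_ ?_ ?_
  · rw [hm.eq_of_nonpos 0 le_rfl, priceCDF, intervalIntegral.integral_same, add_zero,
      mul_div_cancel₀ _ hφ.ne', hg, integral_indicator_const _ measurableSet_Iic, cdf_eq_real,
      smul_eq_mul, mul_one]
  · exact fun s hs => (hC s hs).trans (le_max_left _ _)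
  · intro u _ z _
    linarith [hg1 z, le_max_right C 1, le_max_right z 0]
  · exact fun s hs => hm.renewal_priceCDF hrate hν hφ ν₀ x hs

end BiddingProcess

/-! ### The piecewise form and the density -/

section Density

variable {ν : Measure ℝ} [IsProbabilityMeasure ν]

lemma integral_max_sub_cdf_eq_zero (ν : Measure ℝ) {μ₀ y x : ℝ} (hay : μ₀ ≤ y) (hx : x ≤ μ₀) :
    ∫ w in μ₀..y, max (cdf ν x - cdf ν w) 0 / phi ν w ^ 2 = 0 := by
  rw [intervalIntegral.integral_congr (g := fun _ => 0), intervalIntegral.integral_zero]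
  intro w hw
  rw [uIcc_of_le hay] at hw
  simp [max_eq_right (sub_nonpos.2 (monotone_cdf ν (hx.trans hw.1)))]

lemma integral_max_sub_cdf_of_le (ν : Measure ℝ) {μ₀ y x : ℝ} (hay : μ₀ ≤ y) (hx : y ≤ x) :
    ∫ w in μ₀..y, max (cdf ν x - cdf ν w) 0 / phi ν w ^ 2 =
      ∫ w in μ₀..y, (cdf ν x - cdf ν w) / phi ν w ^ 2 := by
  refine intervalIntegral.integral_congr fun w hw => ?_
  rw [uIcc_of_le hay] at hw
  simp only [max_eq_left (sub_nonneg.2 (monotone_cdf ν (hw.2.trans hx)))]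

lemma priceCDF_eq_piecewise (hν : Integrable (fun x : ℝ => max x 0) ν) (ν₀ : Measure ℝ) {μ₀ y : ℝ}
    (hy : 0 < phi ν y) (hay : μ₀ ≤ y) (x : ℝ) :
    priceCDF ν ν₀ μ₀ x y = phi ν y * (cdf ν₀ x / phi ν μ₀) + phi ν y *
        (if x < μ₀ then 0
         else if x < y then
          1 / phi ν x - 1 / phi ν μ₀ + phiDeriv ν x * ∫ w in μ₀..x, 1 / phi ν w ^ 2
         else
          1 / phi ν y - 1 / phi ν μ₀ + phiDeriv ν x * ∫ w in μ₀..y, 1 / phi ν w ^ 2) := by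
  rw [priceCDF, mul_add, phiDeriv_eq hν]
  congr 2
  split_ifs with h1 h2
  · exact integral_max_sub_cdf_eq_zero ν hay h1.le
  · have h1 := not_lt.1 h1
    have hφx := phi_pos_of_le hν hy h2.le
    rw [← intervalIntegral.integral_add_adjacent_intervals
      (intervalIntegrable_priceCDF_integrand hν hφx h1 x)
      ((intervalIntegrable_priceCDF_integrand hν hy hay x).mono_set
        (by rw [uIcc_of_le h2.le, uIcc_of_le hay]; exact Icc_subset_Icc_left h1)),
      integral_max_sub_cdf_eq_zero ν h2.le le_rfl, add_zero, integral_max_sub_cdf_of_le ν h1 le_rfl,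
      integral_sub_cdf_div_phi_sq hν hφx h1]
  · rw [integral_max_sub_cdf_of_le ν hay (not_lt.1 h2), integral_sub_cdf_div_phi_sq hν hy hay]

/-- The factor of `f` in the density at `z` is the integral of `1 / φ ^ 2` over the `w < z` in
`(μ₀, y]`. -/
lemma ofReal_primitive_eq (hν : Integrable (fun x : ℝ => max x 0) ν) {μ₀ y : ℝ}
    (hy : 0 < phi ν y) (hay : μ₀ ≤ y) (z : ℝ) :
    ENNReal.ofReal (if z < μ₀ then 0
      else if z < y then ∫ w in μ₀..z, 1 / phi ν w ^ 2 else ∫ w in μ₀..y, 1 / phi ν w ^ 2) =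
      ∫⁻ w in Ioc μ₀ y, (Iio z).indicator (fun w => ENNReal.ofReal (1 / phi ν w ^ 2)) w := by
  have hI : IntegrableOn (fun w => 1 / phi ν w ^ 2) (Ioc μ₀ y) :=
    (intervalIntegrable_iff_integrableOn_Ioc_of_le hay).1
      (continuousOn_one_div_phi_sq hν hy hay).intervalIntegrable
  have hnn : ∀ s : Set ℝ, 0 ≤ᵐ[volume.restrict s] fun w => 1 / phi ν w ^ 2 :=
    fun s => ae_of_all _ fun w => by positivity
  rw [lintegral_indicator measurableSet_Iio, Measure.restrict_congr_set Iio_ae_eq_Iic,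
    Measure.restrict_restrict measurableSet_Iic, inter_comm, Ioc_inter_Iic]
  split_ifs with h1 h2
  · rw [Ioc_eq_empty (not_lt.2 ((min_le_right _ _).trans h1.le))]
    simp
  · rw [min_eq_right h2.le, intervalIntegral.integral_of_le (not_lt.1 h1),
      ofReal_integral_eq_lintegral_ofReal (hI.mono_set (Ioc_subset_Ioc_right h2.le)) (hnn _)]
  · rw [min_eq_left (not_lt.1 h2), intervalIntegral.integral_of_le hay,
      ofReal_integral_eq_lintegral_ofReal hI (hnn _)]

lemma measurable_indicator_Iio {c : ℝ → ENNReal} (hc : Measurable c) :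
    Measurable fun p : ℝ × ℝ => (Iio p.1).indicator c p.2 :=
  (hc.comp measurable_snd).indicator (s := {p : ℝ × ℝ | p.2 < p.1})
    (measurableSet_lt measurable_snd measurable_fst)

/-- By Tonelli's theorem, the integral in the distribution function is the integral over `Iic x`
of the factor of `f` in the density. -/
lemma setLIntegral_Iic_primitive (hν : Integrable (fun x : ℝ => max x 0) ν) {μ₀ y : ℝ}
    (hy : 0 < phi ν y) (hay : μ₀ ≤ y) (x : ℝ) :
    ∫⁻ z in Iic x, (∫⁻ w in Ioc μ₀ y,
      (Iio z).indicator (fun w => ENNReal.ofReal (1 / phi ν w ^ 2)) w) ∂ν =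
    ENNReal.ofReal (∫ w in μ₀..y, max (cdf ν x - cdf ν w) 0 / phi ν w ^ 2) := by
  have hφm : Measurable (phi ν) := (lipschitzWith_phi hν).continuous.measurable
  have hcm : Measurable fun w => ENNReal.ofReal (1 / phi ν w ^ 2) := by fun_prop
  rw [lintegral_lintegral_swap (measurable_indicator_Iio hcm).aemeasurable,
    intervalIntegral.integral_of_le hay, ofReal_integral_eq_lintegral_ofReal
    ((intervalIntegrable_iff_integrableOn_Ioc_of_le hay).1
      (intervalIntegrable_priceCDF_integrand hν hy hay x))
    (ae_of_all _ fun w => by positivity)]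
  refine lintegral_congr fun w => ?_
  have e : ∀ z, (Iio z).indicator (fun w => ENNReal.ofReal (1 / phi ν w ^ 2)) w =
      (Ioi w).indicator (fun _ => ENNReal.ofReal (1 / phi ν w ^ 2)) z := by
    intro z
    by_cases h : w < z <;> simp [h]
  simp only [e]
  rw [lintegral_indicator_const measurableSet_Ioi, Measure.restrict_apply measurableSet_Ioi,
    Ioi_inter_Iic, ← ofReal_measureReal, measureReal_Ioc_eq, ← ENNReal.ofReal_mul (by positivity)]
  congr 1
  ring

omit [IsProbabilityMeasure ν] in
lemma setLIntegral_of_eq_withDensity {f : ℝ → ℝ} (hf : AEMeasurable f)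
    (hνf : ν = volume.withDensity fun x => ENNReal.ofReal (f x)) {G : ℝ → ENNReal}
    (hG : Measurable G) {s : Set ℝ} (hs : MeasurableSet s) :
    ∫⁻ z in s, G z ∂ν = ∫⁻ z in s, ENNReal.ofReal (f z) * G z := by
  subst hνf
  rw [restrict_withDensity hs, lintegral_withDensity_eq_lintegral_mul₀
    hf.ennreal_ofReal.restrict hG.aemeasurable]
  rfl

theorem map_eq_withDensity_of_measureReal_le {Ω : Type*} [MeasurableSpace Ω] {P : Measure Ω}
    [IsProbabilityMeasure P] {S : Ω → ℝ} (hS : Measurable S) (ν₀ : Measure ℝ)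
    [IsProbabilityMeasure ν₀]
    (hν : Integrable (fun x : ℝ => max x 0) ν) {μ₀ y : ℝ}
    (hy : 0 < phi ν y) (hay : μ₀ ≤ y)
    (hcdf : ∀ x, P.real {ω | S ω ≤ x} = priceCDF ν ν₀ μ₀ x y) {f f₀ : ℝ → ℝ}
    (hf : AEMeasurable f) (hf0 : ∀ x, 0 ≤ f x) (hf₀ : AEMeasurable f₀) (hf₀0 : ∀ x, 0 ≤ f₀ x)
    (hνf : ν = volume.withDensity (fun x => ENNReal.ofReal (f x)))
    (hν₀f : ν₀ = volume.withDensity (fun x => ENNReal.ofReal (f₀ x))) :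
    P.map S = volume.withDensity (fun x => ENNReal.ofReal
        (phi ν y * (f₀ x / phi ν μ₀) + phi ν y * f x *
          (if x < μ₀ then 0
           else if x < y then ∫ w in μ₀..x, 1 / phi ν w ^ 2
           else ∫ w in μ₀..y, 1 / phi ν w ^ 2))) := by
  have hφm : Measurable (phi ν) := (lipschitzWith_phi hν).continuous.measurable
  have hφ₀ := phi_pos_of_le hν hy hay
  set G : ℝ → ENNReal := fun z => ∫⁻ w in Ioc μ₀ y,
      (Iio z).indicator (fun w => ENNReal.ofReal (1 / phi ν w ^ 2)) w with hG
  have hGm : Measurable G :=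
    (measurable_indicator_Iio (c := fun w => ENNReal.ofReal (1 / phi ν w ^ 2))
      (by fun_prop)).lintegral_prod_right'
  have hJ0 : ∀ z, 0 ≤ if z < μ₀ then 0
      else if z < y then ∫ w in μ₀..z, 1 / phi ν w ^ 2 else ∫ w in μ₀..y, 1 / phi ν w ^ 2 := by
    intro z
    split_ifs with h1 h2
    · exact le_rfl
    · exact intervalIntegral.integral_nonneg (not_lt.1 h1) fun w _ => by positivity
    · exact intervalIntegral.integral_nonneg hay fun w _ => by positivity
  have e : ∀ z, ENNReal.ofReal (phi ν y * (f₀ z / phi ν μ₀) + phi ν y * f z *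
        (if z < μ₀ then 0
          else if z < y then ∫ w in μ₀..z, 1 / phi ν w ^ 2
          else ∫ w in μ₀..y, 1 / phi ν w ^ 2)) =
      ENNReal.ofReal (phi ν y / phi ν μ₀) * ENNReal.ofReal (f₀ z) +
        ENNReal.ofReal (phi ν y) * (ENNReal.ofReal (f z) * G z) := by
    intro z
    rw [ENNReal.ofReal_add (mul_nonneg hy.le (div_nonneg (hf₀0 z) hφ₀.le))
      (mul_nonneg (mul_nonneg hy.le (hf0 z)) (hJ0 z)), mul_assoc,
      ENNReal.ofReal_mul hy.le (q := _ * _), ENNReal.ofReal_mul (hf0 z),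
      ofReal_primitive_eq hν hy hay, ← ENNReal.ofReal_mul (div_nonneg hy.le hφ₀.le)]
    congr 2
    ring
  simp only [e]
  have : IsProbabilityMeasure (P.map S) := Measure.isProbabilityMeasure_map hS.aemeasurable
  refine Measure.ext_of_Iic _ _ fun x => ?_
  have h1 : ∫⁻ z in Iic x, ENNReal.ofReal (f₀ z) = ENNReal.ofReal (cdf ν₀ x) := by
    rw [ofReal_cdf, hν₀f, withDensity_apply _ measurableSet_Iic]
  have h2 : ∫⁻ z in Iic x, ENNReal.ofReal (f z) * G z =
      ENNReal.ofReal (∫ w in μ₀..y, max (cdf ν x - cdf ν w) 0 / phi ν w ^ 2) := by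
    rw [← setLIntegral_of_eq_withDensity hf hνf hGm measurableSet_Iic,
      setLIntegral_Iic_primitive hν hy hay]
  have hint0 : 0 ≤ ∫ w in μ₀..y, max (cdf ν x - cdf ν w) 0 / phi ν w ^ 2 :=
    intervalIntegral.integral_nonneg hay fun w _ => by positivity
  rw [withDensity_apply _ measurableSet_Iic, lintegral_add_left'
    (hf₀.ennreal_ofReal.const_mul _).restrict, lintegral_const_mul' _ _ ENNReal.ofReal_ne_top,
    lintegral_const_mul' _ _ ENNReal.ofReal_ne_top, h1, h2,
    ← ENNReal.ofReal_mul (div_nonneg hy.le hφ₀.le), ← ENNReal.ofReal_mul hy.le,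
    ← ENNReal.ofReal_add (mul_nonneg (div_nonneg hy.le hφ₀.le) (cdf_nonneg _ _))
      (mul_nonneg hy.le hint0), ← ofReal_measureReal]
  congr 1
  rw [map_measureReal_apply hS measurableSet_Iic]
  refine (hcdf x).trans ?_
  rw [priceCDF]
  ring

end Density

theorem mainTheorem4 {Ω : Type*} [MeasurableSpace Ω] (P : Measure Ω) [IsProbabilityMeasure P]
    (rate : ℝ) (hrate : 0 < rate)
    (ν ν₀ : Measure ℝ) [IsProbabilityMeasure ν] [IsProbabilityMeasure ν₀]
    (hν : Integrable (fun x : ℝ => max x 0) ν)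
    (hν₀ : Integrable (fun x : ℝ => x) ν₀)
    (μ₀ : ℝ) (hμ₀ : μ₀ = ∫ x, x ∂ν₀) (hμ₀_nonneg : 0 ≤ μ₀)
    (hμ₀_lt : (μ₀ : EReal) < supportSup ν)
    (B : BiddingProcess P rate ν ν₀) (t : ℝ) (ht : 0 ≤ t) :
    -- all expressions in the formulas are meaningful
    (Measurable (B.salePrice t) ∧ μ₀ ≤ B.policy t ∧
      (∀ x, IntegrableOn (fun u => 1 - cdf ν u) (Ioi x)) ∧
      (∀ x ≤ B.policy t, 0 < phi ν x) ∧
      IntervalIntegrable (fun w => 1 / phi ν w ^ 2) volume μ₀ (B.policy t) ∧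
      (∀ x, IntervalIntegrable (fun w => max (cdf ν x - cdf ν w) 0 / phi ν w ^ 2) volume
        μ₀ (B.policy t)) ∧
      (∀ x, HasDerivWithinAt (phi ν) (phiDeriv ν x) (Ici x) x ∧ phiDeriv ν x = cdf ν x - 1)) ∧
    -- the distribution function of the sale price
    (∀ x, B.salePriceCDF t x =
      phi ν (B.policy t) * (cdf ν₀ x / phi ν μ₀ +
        ∫ w in μ₀..B.policy t, max (cdf ν x - cdf ν w) 0 / phi ν w ^ 2)) ∧
    -- its three pieces
    (∀ x, B.salePriceCDF t x =
      phi ν (B.policy t) * (cdf ν₀ x / phi ν μ₀) + phi ν (B.policy t) *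
        (if x < μ₀ then 0
         else if x < B.policy t then
          1 / phi ν x - 1 / phi ν μ₀ + phiDeriv ν x * ∫ w in μ₀..x, 1 / phi ν w ^ 2
         else
          1 / phi ν (B.policy t) - 1 / phi ν μ₀ +
            phiDeriv ν x * ∫ w in μ₀..B.policy t, 1 / phi ν w ^ 2)) ∧
    -- its density
    (∀ f f₀ : ℝ → ℝ, AEMeasurable f → (∀ x, 0 ≤ f x) → AEMeasurable f₀ → (∀ x, 0 ≤ f₀ x) →
      ν = volume.withDensity (fun x => ENNReal.ofReal (f x)) →
      ν₀ = volume.withDensity (fun x => ENNReal.ofReal (f₀ x)) →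
      P.map (B.salePrice t) = volume.withDensity (fun x => ENNReal.ofReal
        (phi ν (B.policy t) * (f₀ x / phi ν μ₀) + phi ν (B.policy t) * f x *
          (if x < μ₀ then 0
           else if x < B.policy t then ∫ w in μ₀..x, 1 / phi ν w ^ 2
           else ∫ w in μ₀..B.policy t, 1 / phi ν w ^ 2)))) := by
  have hφ : 0 < phi ν μ₀ := phi_pos_of_lt_supportSup hν hμ₀_lt
  obtain ⟨m, hm⟩ := exists_isValueFunction hrate hν μ₀
  have hpol : ∀ s, 0 ≤ s → B.policy s = m s := fun s hs =>
    BiddingProcess.policy_eq hrate hν hν₀ hμ₀ hμ₀_nonneg hm hs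
  have hS : B.salePrice t = B.payoff t (B.thresholdRule t m) := by
    funext ω
    rw [BiddingProcess.salePrice, BiddingProcess.optimalRule_eq_thresholdRule hpol]
  have hSm : Measurable (B.salePrice t) := hS ▸ BiddingProcess.measurable_payoff
    (BiddingProcess.isStoppingTime_thresholdRule hm.continuous.measurable t) t
  have hpos : 0 < phi ν (B.policy t) := hpol t ht ▸ hm.phi_pos hrate hν hφ t
  have hle : μ₀ ≤ B.policy t := hpol t ht ▸ hm.initial_le hrate hν t
  have hcdf : ∀ x, B.salePriceCDF t x = priceCDF ν ν₀ μ₀ x (B.policy t) := fun x => by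
    rw [hpol t ht, BiddingProcess.salePriceCDF, hS]
    exact BiddingProcess.measureReal_payoff_thresholdRule_le hrate hν hφ hm ht x
  refine ⟨⟨hSm, hle, integrableOn_one_sub_cdf hν, fun x hx => phi_pos_of_le hν hpos hx,
    (continuousOn_one_div_phi_sq hν hpos hle).intervalIntegrable,
    intervalIntegrable_priceCDF_integrand hν hpos hle, fun x => ?_⟩, hcdf, fun x => ?_, ?_⟩
  · rw [phiDeriv_eq hν]
    exact ⟨hasDerivWithinAt_phi hν x, rfl⟩
  · rw [hcdf, priceCDF_eq_piecewise hν ν₀ hpos hle]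
  · intro f f₀ hf hf0 hf₀ hf₀0 hνf hν₀f
    exact map_eq_withDensity_of_measureReal_le hSm ν₀ hν hpos hle hcdf hf hf0 hf₀ hf₀0 hνf hν₀f
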